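/- Let $A\in\mathbb R^{n\times n}$ be symmetric with eigenvalues $\lambda_1<\dots<\lambda_k<\tau_0<\lambda_{k+1}\le\dots\le\lambda_n$ for some $1\le k<n$ and $\tau_0\in\mathbb R$, let $q_1\in\mathbb R^n$ with $\|q_1\|=1$, let $m\ge k$ be an integer and let $0<\mathrm{tol}<1/2$. Write $e_m$ for the last unit vector of $\mathbb R^m$ and $\chi_\tau(x)=1$ if $x<\tau$, $\chi_\tau(x)=0$ otherwise. *Compression matrices.* Let $T\in\mathbb R^{m\times m}$ be symmetric with eigenvalues $\theta_1\le\dots\le\theta_m$ and orthonormal eigenvectors $s_1,\dots,s_m$. A matrix $V\in\mathbb R^{m\times \ell}$, $\ell<m$, with orthonormal columns is an admissible compression matrix for $T$ if there are an integer $\hat k$ with $k\le\hat k\le m-1$ and $\theta_k<\theta_{\hat k+1}$, and a real rational function $r=p/q$ with $q(\theta_i)\ne0$ for all $i$, such that, with $\tau=(\theta_k+\theta_{\hat k+1})/2$, $$|r(x)-\chi_\tau(x)|<\mathrm{tol}\qquad\text{for all }x\in[\lambda_1,\theta_m]\setminus(\theta_k,\theta_{\hat k+1})$$ (in particular $q(x)\neq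 0$ there), and $$\operatorname{range}(V)=\operatorname{span}\{s_1,\dots,s_{\hat k}\}+\bigl\{q(T)^{-1}f(T)e_m: f\in\mathbb R[x],\ \deg f<\max(\deg p+1,\deg q)\bigr\},\qquad e_m\in\operatorname{range}(V).$$ (The last condition holds automatically if $\deg p\ge\deg q$, that is, if $r$ has a pole at infinity.) *Lanczos with compression (exact arithmetic).* Start with the basis $Q=[q_1]$ and $i=1$. In iteration $i$, let $q_i$ be the last column of the current orthonormal basis $Q$, and compute $z=(I-QQ^T)Aq_i$ (one matrix-vector multiplication with $A$). If $Q$ has $m$ columns, the method either stops or replaces $Q$ by $QV$ (a compression), where $V$ is any admissible compression matrix for $T=Q^TAQ$; $V$, $\ell$, $\hat k$ and $r$ may differ from one compression to the next. Then, provided that $z\ne0$ (no breakdown), $q_{i+1}=z/\|z\|$ is appended to the basis as its last column and $i$ is increased by one. When the method stops, it returns the Ritz vectors $U=Q[s_1,\dots,s_k]\in\mathbb R^{n\times k}$, where $s_1,\dots,s_k$ are orthonormal eigenvectors belonging to the $k$ smallest eigenvalues of $Q^TAQ$. Suppose that the method stops after $\kappa$ compressions and $N$ matrix-vector multiplications in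 total (that is, in iteration $i=N$) and returns $U$. Let $T_N$ be the $N\times N$ symmetric tridiagonal matrix produced by $N$ iterations of the standard (unrestarted, uncompressed) Lanczos process for $A$ with initial vector $q_1$, and let $\lambda_i(T_N)$ denote its $i$th smallest eigenvalue. Then $$\operatorname{Tr}(U^TAU)-\sum_{i=1}^k\lambda_i(T_N)\le 4k\kappa(\lambda_n-\lambda_1)\,\mathrm{tol}^2 .$$ -/

import Mathlib

open Matrix Polynomial

noncomputable section

namespace LanczosCompression

/-- Euclidean norm of a coordinate vector. -/
def euclNorm {n : ℕ} (v : Fin n → ℝ) : ℝ := ‖WithLp.toLp 2 v‖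

/-- `θ 0 ≤ θ 1 ≤ ⋯` are the eigenvalues of `T` (with multiplicity), and the columns of `S` are
associated orthonormal eigenvectors. -/
structure IsOrderedEigendecomposition {N : ℕ} (T : Matrix (Fin N) (Fin N) ℝ) (θ : Fin N → ℝ)
    (S : Matrix (Fin N) (Fin N) ℝ) : Prop where
  mono : Monotone θ
  orthonormal : Sᵀ * S = 1
  eigen : T * S = S * Matrix.diagonal θ

/-! ### The standard Lanczos process

The Lanczos vectors `q₁, q₂, …` are numbered from `0` here. -/

/-- The residual `A v - (vᵀ A v) v - b p` of the three-term recurrence. -/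
def threeTerm {n : ℕ} (A : Matrix (Fin n) (Fin n) ℝ) (p v : Fin n → ℝ) (b : ℝ) : Fin n → ℝ :=
  A *ᵥ v - (v ⬝ᵥ A *ᵥ v) • v - b • p

/-- State of the Lanczos process: previous vector, current vector, and the coefficient
`β` linking them (both `0` at the start). -/
def lanczosState {n : ℕ} (A : Matrix (Fin n) (Fin n) ℝ) (q₁ : Fin n → ℝ) :
    ℕ → (Fin n → ℝ) × (Fin n → ℝ) × ℝ
  | 0 => (0, q₁, 0)
  | i + 1 =>
    let s := lanczosState A q₁ i
    let w := threeTerm A s.1 s.2.1 s.2.2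
    (s.2.1, (euclNorm w)⁻¹ • w, euclNorm w)

/-- The Lanczos vector `q_{i+1}`. -/
def lanczosVec {n : ℕ} (A : Matrix (Fin n) (Fin n) ℝ) (q₁ : Fin n → ℝ) (i : ℕ) : Fin n → ℝ :=
  (lanczosState A q₁ i).2.1

/-- The diagonal coefficient `α_{i+1} = q_{i+1}ᵀ A q_{i+1}`. -/
def lanczosAlpha {n : ℕ} (A : Matrix (Fin n) (Fin n) ℝ) (q₁ : Fin n → ℝ) (i : ℕ) : ℝ :=
  lanczosVec A q₁ i ⬝ᵥ A *ᵥ lanczosVec A q₁ i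

/-- The off-diagonal coefficient `β_{i+1}`, linking `q_{i+1}` and `q_{i+2}`. -/
def lanczosBeta {n : ℕ} (A : Matrix (Fin n) (Fin n) ℝ) (q₁ : Fin n → ℝ) (i : ℕ) : ℝ :=
  (lanczosState A q₁ (i + 1)).2.2

/-- The symmetric tridiagonal matrix produced by `N` Lanczos iterations. -/
def lanczosMatrix {n : ℕ} (A : Matrix (Fin n) (Fin n) ℝ) (q₁ : Fin n → ℝ) (N : ℕ) :
    Matrix (Fin N) (Fin N) ℝ :=
  Matrix.of fun i j =>
    if i = j then lanczosAlpha A q₁ i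
    else if (i : ℕ) + 1 = j then lanczosBeta A q₁ i
    else if (j : ℕ) + 1 = i then lanczosBeta A q₁ j
    else 0

/-! ### Rational Krylov compression -/

/-- The step function `χ_τ`. -/
def stepFun (τ x : ℝ) : ℝ := if x < τ then 1 else 0

/-- The number of poles of `p / q`: the zeros of `q`, supplemented by `deg p - deg q + 1` infinite
poles if `deg p ≥ deg q`. -/
def poleCount (p q : ℝ[X]) : ℕ := max (p.natDegree + 1) q.natDegree

/-- The last unit vector `e_m`. -/
def lastUnit (m : ℕ) : Fin m → ℝ := fun i => if (i : ℕ) + 1 = m then 1 else 0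

/-- The rational Krylov space of all `(f / q)(T) e` with `deg f < N`, that is, the one
with `N` poles, given by the zeros of `q` and `N - deg q` times the pole `∞`. -/
def rationalKrylov {m : ℕ} (T : Matrix (Fin m) (Fin m) ℝ) (e : Fin m → ℝ) (q : ℝ[X]) (N : ℕ) :
    Submodule ℝ (Fin m → ℝ) :=
  Submodule.span ℝ {v | ∃ f : ℝ[X], f.degree < N ∧ v = (aeval T q)⁻¹ *ᵥ (aeval T f *ᵥ e)}

/-- `V` is an admissible compression matrix for the symmetric matrix `T`, obtained by rational
approximation of a step function with tolerance `tol` on a set bounded below by `lmin`.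
The eigenvalues `θ_k`, `θ_{k'+1}` of the usual `1`-based numbering are `θ (k - 1)`, `θ k'` here.

* `θ_k < θ_{k'+1}` for some `k ≤ k' ≤ m - 1`, and `τ = (θ_k + θ_{k'+1}) / 2`;
* the real rational function `r = p / q` has no pole among the eigenvalues of `T`, and it satisfies
  `|r - χ_τ| < tol` on `[lmin, θ_m] \ (θ_k, θ_{k'+1})`;
* the columns of `V` are an orthonormal basis of
  `span {s_1, …, s_{k'}} + rationalKrylov`, with fewer than `m` columns;
* `e_m` lies in the range of `V`, as is required for continuing the Lanczos process after the
  compression (it does whenever `r` has a pole at infinity, that is, `deg q ≤ deg p`). -/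
def IsCompressionMatrix {m l : ℕ} (k : ℕ) (tol lmin : ℝ) (T : Matrix (Fin m) (Fin m) ℝ)
    (V : Matrix (Fin m) (Fin l) ℝ) : Prop :=
  ∃ (θ : Fin m → ℝ) (S : Matrix (Fin m) (Fin m) ℝ) (k' : ℕ) (hk : k ≤ k') (hk' : k' < m)
    (p q : ℝ[X]),
    IsOrderedEigendecomposition T θ S ∧
    θ ⟨k - 1, by omega⟩ < θ ⟨k', hk'⟩ ∧
    (∀ i, q.eval (θ i) ≠ 0) ∧
    (∀ x ∈ Set.Icc lmin (θ ⟨m - 1, by omega⟩) \ Set.Ioo (θ ⟨k - 1, by omega⟩) (θ ⟨k', hk'⟩),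
      q.eval x ≠ 0 ∧
      |p.eval x / q.eval x
        - stepFun ((θ ⟨k - 1, by omega⟩ + θ ⟨k', hk'⟩) / 2) x| < tol) ∧
    Vᵀ * V = 1 ∧
    Submodule.span ℝ (Set.range V.col) =
      Submodule.span ℝ (S.col '' {i | (i : ℕ) < k'}) ⊔
        rationalKrylov T (lastUnit m) q (poleCount p q) ∧
    l < m ∧
    lastUnit m ∈ Submodule.span ℝ (Set.range V.col)

/-! ### Lanczos with compression -/

/-- `[Q, v]`. -/
def appendCol {n j : ℕ} (Q : Matrix (Fin n) (Fin j) ℝ) (v : Fin n → ℝ) :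
    Matrix (Fin n) (Fin (j + 1)) ℝ :=
  Matrix.of fun r => (Fin.snoc (Q r) (v r) : Fin (j + 1) → ℝ)

/-- `(I - Q Qᵀ) A v`: the product `A v` orthogonalized against the current basis. -/
def expansionResidual {n j : ℕ} (A : Matrix (Fin n) (Fin n) ℝ) (Q : Matrix (Fin n) (Fin j) ℝ)
    (v : Fin n → ℝ) : Fin n → ℝ :=
  A *ᵥ v - Q *ᵥ (Qᵀ *ᵥ (A *ᵥ v))

/-- The next Lanczos vector: the normalized residual. -/
def nextVec {n j : ℕ} (A : Matrix (Fin n) (Fin n) ℝ) (Q : Matrix (Fin n) (Fin j) ℝ)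
    (v : Fin n → ℝ) : Fin n → ℝ :=
  (euclNorm (expansionResidual A Q v))⁻¹ • expansionResidual A Q v

/-- Reachable states of Lanczos with compression in exact arithmetic. `Run A q₁ k m tol lmin c i j Q v`
says that in the loop iteration number `i` (each iteration performs the single matrix-vector
multiplication `A v`), after `c` compressions, the current orthonormal basis is `Q`, with `j`
columns, the last of which is `v`. While `j < m` the next Lanczos vector is appended. Once `j = m`
the basis is compressed to `Q V`, where `V` is built from `T = Qᵀ A Q`, and the next Lanczos vector
(computed before the compression) is appended. The process continues only if it does not break
down, that is, if the residual does not vanish. The compression matrix, in particular its number `l`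
of columns, may be different in each compression. -/
inductive Run {n : ℕ} (A : Matrix (Fin n) (Fin n) ℝ) (q₁ : Fin n → ℝ) (k m : ℕ) (tol lmin : ℝ) :
    (c i j : ℕ) → Matrix (Fin n) (Fin j) ℝ → (Fin n → ℝ) → Prop
  | init : Run A q₁ k m tol lmin 0 1 1 (Matrix.of fun r _ => q₁ r) q₁
  | expand {c i j : ℕ} {Q : Matrix (Fin n) (Fin j) ℝ} {v : Fin n → ℝ}
      (h : Run A q₁ k m tol lmin c i j Q v) (hj : j < m)
      (hz : expansionResidual A Q v ≠ 0) :
      Run A q₁ k m tol lmin c (i + 1) (j + 1) (appendCol Q (nextVec A Q v)) (nextVec A Q v)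
  | compress {c i l : ℕ} {Q : Matrix (Fin n) (Fin m) ℝ} {v : Fin n → ℝ}
      (h : Run A q₁ k m tol lmin c i m Q v) (V : Matrix (Fin m) (Fin l) ℝ)
      (hV : IsCompressionMatrix k tol lmin (Qᵀ * A * Q) V)
      (hz : expansionResidual A Q v ≠ 0) :
      Run A q₁ k m tol lmin (c + 1) (i + 1) (l + 1)
        (appendCol (Q * V) (nextVec A Q v)) (nextVec A Q v)

/-- The columns of `U` are Ritz vectors returned by Lanczos with compression after `κ` compressions
and `N` matrix-vector multiplications: the method may stop whenever the basis `Q` has reached `m`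
columns, and then returns the Ritz vectors `Q s_1, …, Q s_k` that belong to the `k` smallest
eigenvalues of `Qᵀ A Q`. -/
def Returns {n k : ℕ} (A : Matrix (Fin n) (Fin n) ℝ) (q₁ : Fin n → ℝ) (m : ℕ) (tol lmin : ℝ)
    (κ N : ℕ) (U : Matrix (Fin n) (Fin k) ℝ) : Prop :=
  ∃ (Q : Matrix (Fin n) (Fin m) ℝ) (v : Fin n → ℝ) (θ : Fin m → ℝ)
    (S : Matrix (Fin m) (Fin m) ℝ) (hkm : k ≤ m),
    Run A q₁ k m tol lmin κ N m Q v ∧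
    IsOrderedEigendecomposition (Qᵀ * A * Q) θ S ∧
    U = Q * S.submatrix id (Fin.castLE hkm)

end LanczosCompression

end

noncomputable section

namespace LanczosCompression

/-! ### Weighted sums of ordered real numbers -/

/-! In exact arithmetic, compression does not alter the Lanczos vectors: the basis always contains
the current and the previous one, so orthogonalizing against it leaves exactly the three-term
residual (`Run.exists_isLanczosBasis`). Let F be the span of the current basis together with the
Lanczos vectors still to come, up to number N. F starts as the Krylov space belonging to `T_N`, is
unchanged by an expansion, shrinks in a compression, and ends as the final search space. By Ky Fan's
principle it suffices that one compression raises the minimal Rayleigh trace over k-frames in F by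
at most 4k(λ_n - λ_1)tol² (`HasRayleighTraceLE.compress`, iterated in `Run.hasRayleighTraceLE`).

Let x = Qa + d be one of the first k Ritz vectors of F, with Ritz value λ and d in the span of the
later Lanczos vectors. Only two adjacent Lanczos vectors couple the two parts, so the Ritz condition
tested on Q reads (λ - T)a = γ e_m. Hence (1 - r(T)/r(λ))a is a divided difference of r applied to
e_m and lies in the rational Krylov space. The remainder r(T)a/r(λ) has coefficients below 2 tol
times those of a along the unwanted eigenvectors, since λ ≤ θ_k by interlacing gives r(λ) > 1/2; its
other components lie in the span of the retained eigenvectors. So x is within 2 tol of the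
compressed space (`IsCompressionMatrix.exists_dotProduct_sub_le`), where d is still available.

Finally, the trace error is quadratic in this distance (`IsRitzSystem.exists_orthonormal_sum_le`),
and all Ritz values lie in [λ_1, λ_n]. -/

theorem sum_filter_lt_const {d k : ℕ} (hkd : k ≤ d) (c : ℝ) :
    ∑ _i ∈ Finset.univ.filter (fun i : Fin d => (i : ℕ) < k), c = k * c := by
  have : (Finset.univ.filter (fun i : Fin d => (i : ℕ) < k)).card = k := by
    rw [Fin.card_filter_val_lt]; omega
  rw [Finset.sum_const, this, nsmul_eq_mul]

/-- Shifting `lam` by its k-th value changes both sides equally, because the weights have total k.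
After the shift, the first k terms are nonpositive and the rest nonnegative, so the comparison holds
term by term. -/
theorem sum_filter_lt_le_sum_mul {d k : ℕ} (hk : 1 ≤ k) (hkd : k ≤ d) {lam w : Fin d → ℝ}
    (hlam : Monotone lam) (hw0 : ∀ i, 0 ≤ w i) (hw1 : ∀ i, w i ≤ 1) (hw : ∑ i, w i = k) :
    ∑ i ∈ Finset.univ.filter (fun i : Fin d => (i : ℕ) < k), lam i ≤ ∑ i, lam i * w i := by
  set c := lam ⟨k - 1, by omega⟩ with hc
  have h1 : ∑ i ∈ Finset.univ.filter (fun i : Fin d => (i : ℕ) < k), (lam i - c) ≤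
      ∑ i, (lam i - c) * w i := by
    rw [Finset.sum_filter]
    refine Finset.sum_le_sum fun i _ => ?_
    split_ifs with h
    · have : lam i ≤ c := hlam (Fin.le_def.2 (by simp only; omega))
      nlinarith [hw1 i]
    · have : c ≤ lam i := hlam (Fin.le_def.2 (by simp only; omega))
      exact mul_nonneg (by linarith) (hw0 i)
  rw [Finset.sum_sub_distrib, sum_filter_lt_const hkd] at h1
  simp only [sub_mul, Finset.sum_sub_distrib, ← Finset.mul_sum, hw] at h1
  linarith

/-- Any weight missing from the first k indices is moved to other indices, where it costs at most
`M`. -/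
theorem sum_mul_le_sum_filter_lt_add {d k : ℕ} (hkd : k ≤ d) {lam w : Fin d → ℝ} {M : ℝ}
    (hlam : ∀ i, lam i ≤ M) (hw0 : ∀ i, 0 ≤ w i) (hw : ∑ i, w i = k) :
    ∑ i, lam i * w i ≤ ∑ i ∈ Finset.univ.filter (fun i : Fin d => (i : ℕ) < k), lam i +
      ∑ i ∈ Finset.univ.filter (fun i : Fin d => (i : ℕ) < k), (M - lam i) * (1 - w i) := by
  have h1 : ∑ i ∈ Finset.univ.filter (fun i : Fin d => (i : ℕ) < k), (M - lam i) * w i ≤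
      ∑ i, (M - lam i) * w i :=
    Finset.sum_le_sum_of_subset_of_nonneg (Finset.filter_subset _ _)
      fun i _ _ => mul_nonneg (by linarith [hlam i]) (hw0 i)
  have h2 : ∑ i, (M - lam i) * w i = M * k - ∑ i, lam i * w i := by
    simp only [sub_mul, Finset.sum_sub_distrib, ← Finset.mul_sum, hw]
  have h3 : ∑ i ∈ Finset.univ.filter (fun i : Fin d => (i : ℕ) < k), (M - lam i) * (1 - w i) =
      k * M - ∑ i ∈ Finset.univ.filter (fun i : Fin d => (i : ℕ) < k), lam i -
      ∑ i ∈ Finset.univ.filter (fun i : Fin d => (i : ℕ) < k), (M - lam i) * w i := by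
    rw [← sum_filter_lt_const hkd M, ← Finset.sum_sub_distrib, ← Finset.sum_sub_distrib]
    exact Finset.sum_congr rfl fun i _ => by ring
  linarith

/-! ### Ritz systems -/

variable {E : Type*} [NormedAddCommGroup E] [InnerProductSpace ℝ E]

/-- An orthonormal basis `x` of the subspace `F` consisting of Ritz vectors of `A`, with the Ritz
values `lam` in increasing order. -/
structure IsRitzSystem (A : E →ₗ[ℝ] E) (F : Submodule ℝ E) {d : ℕ} (lam : Fin d → ℝ)
    (x : Fin d → E) : Prop where
  mono : Monotone lam
  orthonormal : Orthonormal ℝ x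
  span_eq : Submodule.span ℝ (Set.range x) = F
  ritz : ∀ i, ∀ w ∈ F, inner ℝ w (A (x i)) = lam i * inner ℝ w (x i)

theorem _root_.Orthonormal.sum_inner_smul_eq {d : ℕ} {x : Fin d → E} (hx : Orthonormal ℝ x) {u : E}
    (hu : u ∈ Submodule.span ℝ (Set.range x)) : ∑ i, inner ℝ (x i) u • x i = u := by
  obtain ⟨c, rfl⟩ := (Submodule.mem_span_range_iff_exists_fun ℝ).1 hu
  exact Finset.sum_congr rfl fun i _ => by rw [hx.inner_right_fintype]

theorem _root_.Orthonormal.sum_inner_sq_eq {d : ℕ} {x : Fin d → E} (hx : Orthonormal ℝ x) {u : E}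
    (hu : u ∈ Submodule.span ℝ (Set.range x)) : ∑ i, inner ℝ (x i) u ^ 2 = ‖u‖ ^ 2 := by
  rw [← real_inner_self_eq_norm_sq]
  conv_rhs => rw [← hx.sum_inner_smul_eq hu]
  rw [hx.inner_sum]
  simp [sq]

theorem _root_.Orthonormal.sum_inner_sq_le {ι : Type*} [Fintype ι] {x : ι → E}
    (hx : Orthonormal ℝ x) (u : E) : ∑ i, inner ℝ (x i) u ^ 2 ≤ ‖u‖ ^ 2 := by
  simpa using hx.sum_inner_products_le (s := Finset.univ) u

namespace IsRitzSystem

variable {A : E →ₗ[ℝ] E} {F : Submodule ℝ E} {d : ℕ} {lam : Fin d → ℝ} {x : Fin d → E}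

theorem mem (h : IsRitzSystem A F lam x) (i : Fin d) : x i ∈ F :=
  h.span_eq ▸ Submodule.subset_span ⟨i, rfl⟩

theorem inner_map_self (h : IsRitzSystem A F lam x) {u : E} (hu : u ∈ F) :
    inner ℝ u (A u) = ∑ i, lam i * inner ℝ (x i) u ^ 2 := by
  have hs := h.orthonormal.sum_inner_smul_eq (h.span_eq.symm ▸ hu)
  have : inner ℝ u (A u) = inner ℝ u (A (∑ i, inner ℝ (x i) u • x i)) := by rw [hs]
  rw [this, map_sum, inner_sum]
  refine Finset.sum_congr rfl fun i _ => ?_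
  rw [map_smul, inner_smul_right, h.ritz i u hu, real_inner_comm u]
  ring

theorem sum_inner_sq (h : IsRitzSystem A F lam x) {u : E} (hu : u ∈ F) :
    ∑ i, inner ℝ (x i) u ^ 2 = ‖u‖ ^ 2 :=
  h.orthonormal.sum_inner_sq_eq (h.span_eq.symm ▸ hu)

theorem inner_map_apply (h : IsRitzSystem A F lam x) (i : Fin d) :
    inner ℝ (x i) (A (x i)) = lam i := by
  rw [h.ritz i _ (h.mem i), real_inner_self_eq_norm_sq, h.orthonormal.1 i]; ring

theorem finrank_eq (h : IsRitzSystem A F lam x) : Module.finrank ℝ F = d := by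
  rw [← h.span_eq, finrank_span_eq_card h.orthonormal.linearIndependent, Fintype.card_fin]

theorem le_inner_map_self (h : IsRitzSystem A F lam x) {a : ℝ} (ha : ∀ i, a ≤ lam i) {u : E}
    (hu : u ∈ F) : a * ‖u‖ ^ 2 ≤ inner ℝ u (A u) := by
  rw [h.inner_map_self hu, ← h.sum_inner_sq hu, Finset.mul_sum]
  exact Finset.sum_le_sum fun i _ => mul_le_mul_of_nonneg_right (ha i) (sq_nonneg _)

theorem inner_map_self_le (h : IsRitzSystem A F lam x) {b : ℝ} (hb : ∀ i, lam i ≤ b) {u : E}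
    (hu : u ∈ F) : inner ℝ u (A u) ≤ b * ‖u‖ ^ 2 := by
  rw [h.inner_map_self hu, ← h.sum_inner_sq hu, Finset.mul_sum]
  exact Finset.sum_le_sum fun i _ => mul_le_mul_of_nonneg_right (hb i) (sq_nonneg _)

theorem sum_inner_map_self (h : IsRitzSystem A F lam x) {k : ℕ} {u : Fin k → E}
    (huF : ∀ j, u j ∈ F) :
    ∑ j, inner ℝ (u j) (A (u j)) = ∑ i, lam i * ∑ j, inner ℝ (u j) (x i) ^ 2 := by
  simp only [fun j => h.inner_map_self (huF j), Finset.mul_sum]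
  rw [Finset.sum_comm]
  simp only [real_inner_comm]

theorem sum_sum_inner_sq (h : IsRitzSystem A F lam x) {k : ℕ} {u : Fin k → E}
    (hu : Orthonormal ℝ u) (huF : ∀ j, u j ∈ F) : ∑ i, ∑ j, inner ℝ (u j) (x i) ^ 2 = k := by
  rw [Finset.sum_comm]
  have : ∀ j, ∑ i, inner ℝ (u j) (x i) ^ 2 = 1 := fun j => by
    simp only [real_inner_comm, h.sum_inner_sq (huF j), hu.1 j, one_pow]
  simp [this]

/-- The trace minimization principle of Ky Fan. -/
theorem sum_le_sum_inner_map_self (h : IsRitzSystem A F lam x) {k : ℕ} (hk : 1 ≤ k) (hkd : k ≤ d)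
    {u : Fin k → E} (hu : Orthonormal ℝ u) (huF : ∀ j, u j ∈ F) :
    ∑ i ∈ Finset.univ.filter (fun i : Fin d => (i : ℕ) < k), lam i ≤
      ∑ j, inner ℝ (u j) (A (u j)) := by
  rw [h.sum_inner_map_self huF]
  refine sum_filter_lt_le_sum_mul hk hkd h.mono (fun i => Finset.sum_nonneg fun j _ => sq_nonneg _)
    (fun i => ?_) (h.sum_sum_inner_sq hu huF)
  simpa [h.orthonormal.1 i] using hu.sum_inner_sq_le (x i)

/-- The spectral theorem applied to the compression of `A` to `F`; indices are reversed because the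
library orders eigenvalues decreasingly. -/
theorem exists_of_isSymmetric [FiniteDimensional ℝ E] (hA : A.IsSymmetric) (F : Submodule ℝ E) :
    ∃ (lam : Fin (Module.finrank ℝ F) → ℝ) (x : Fin (Module.finrank ℝ F) → E),
      IsRitzSystem A F lam x := by
  have key : ∀ v w : F, inner ℝ w (F.orthogonalProjectionOnto (A v)) = inner ℝ (w : E) (A v) := by
    intro v w
    rw [Submodule.coe_inner, real_inner_comm, real_inner_comm (A v)]
    exact Submodule.inner_orthogonalProjectionOnto_eq_of_mem_right w (A v)
  let B : F →ₗ[ℝ] F := F.orthogonalProjectionOnto.toLinearMap ∘ₗ A ∘ₗ F.subtype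
  have hB : B.IsSymmetric := fun v w => by
    change inner ℝ (F.orthogonalProjectionOnto (A v)) w = inner ℝ v (F.orthogonalProjectionOnto (A w))
    rw [key, real_inner_comm, key, real_inner_comm]
    exact hA _ _
  refine ⟨fun i => hB.eigenvalues rfl i.rev, fun i => hB.eigenvectorBasis rfl i.rev,
    fun i j hij => hB.eigenvalues_antitone rfl (Fin.rev_le_rev.2 hij), ?_, ?_, fun i w hw => ?_⟩
  · exact ((hB.eigenvectorBasis rfl).orthonormal.comp_linearIsometry F.subtypeₗᵢ).comp _
      Fin.rev_injective
  · have h1 : Set.range (fun i : Fin (Module.finrank ℝ F) => ((hB.eigenvectorBasis rfl i.rev : F) : E)) =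
        F.subtype '' Set.range (hB.eigenvectorBasis rfl) := by
      rw [← Set.range_comp]
      exact (Fin.rev_surjective.range_comp (F.subtype ∘ hB.eigenvectorBasis rfl))
    rw [h1, ← Submodule.map_span, ← OrthonormalBasis.coe_toBasis, Module.Basis.span_eq]
    simp
  · have h2 := congrArg (inner ℝ (⟨w, hw⟩ : F)) (hB.apply_eigenvectorBasis rfl i.rev)
    change inner ℝ (⟨w, hw⟩ : F)
      (F.orthogonalProjectionOnto (A (hB.eigenvectorBasis rfl i.rev : F))) = _ at h2
    rw [key, inner_smul_right] at h2
    exact h2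

/-- Cauchy interlacing for the `k`-th Ritz values of nested subspaces. -/
theorem apply_le_apply_of_le (h : IsRitzSystem A F lam x) {R : Submodule ℝ E} {e : ℕ}
    {θ : Fin e → ℝ} {s : Fin e → E} (h' : IsRitzSystem A R θ s) (hRF : R ≤ F) {k : ℕ}
    (hd : k < d) (he : k < e) : lam ⟨k, hd⟩ ≤ θ ⟨k, he⟩ := by
  -- A kernel element of `f` is a combination of the first k + 1 Ritz vectors of `R` that is
  -- orthogonal to the first k Ritz vectors of `F`; one exists by dimension. Its Rayleigh quotient
  -- separates the two Ritz values.
  let f : (Fin (k + 1) → ℝ) →ₗ[ℝ] (Fin k → ℝ) := LinearMap.pi fun i : Fin k =>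
    (innerₛₗ ℝ (x ⟨i, i.2.trans hd⟩)) ∘ₗ
      Fintype.linearCombination ℝ (fun j : Fin (k + 1) => s ⟨j, by omega⟩)
  have hf : LinearMap.ker f ≠ ⊥ := LinearMap.ker_ne_bot_of_finrank_lt (by simp)
  obtain ⟨c, hc, hc0⟩ := (Submodule.ne_bot_iff _).1 hf
  set u : E := Fintype.linearCombination ℝ (fun j : Fin (k + 1) => s ⟨j, by omega⟩) c with hu
  have hsum : u = ∑ j : Fin (k + 1), c j • s ⟨j, by omega⟩ := Fintype.linearCombination_apply ..
  have hs' : Orthonormal ℝ (fun j : Fin (k + 1) => s ⟨j, by omega⟩) :=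
    h'.orthonormal.comp _ fun a b hab => by simpa [Fin.ext_iff] using hab
  have hxu : ∀ i : Fin d, (i : ℕ) < k → inner ℝ (x i) u = 0 := fun i hi =>
    congrFun (LinearMap.mem_ker.1 hc) ⟨i, hi⟩
  have hsu : ∀ i : Fin e, k < (i : ℕ) → inner ℝ (s i) u = 0 := fun i hi => by
    rw [hsum, inner_sum]
    refine Finset.sum_eq_zero fun j _ => ?_
    rw [inner_smul_right, h'.orthonormal.2 (fun hij => ?_), mul_zero]
    rw [hij] at hi; simp only at hi; omega
  have huR : u ∈ R := hsum ▸ Submodule.sum_mem _ fun j _ => Submodule.smul_mem _ _ (h'.mem _)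
  have hu0 : 0 < ‖u‖ ^ 2 := by
    have : u ≠ 0 := fun h0 => hc0 <| by
      funext j
      have h1 := hs'.inner_right_fintype c j
      rw [← hsum, h0, inner_zero_right] at h1
      exact h1.symm
    positivity
  have h1 : lam ⟨k, hd⟩ * ‖u‖ ^ 2 ≤ inner ℝ u (A u) := by
    rw [h.inner_map_self (hRF huR), ← h.sum_inner_sq (hRF huR), Finset.mul_sum]
    refine Finset.sum_le_sum fun i _ => ?_
    by_cases hi : (i : ℕ) < k
    · simp [hxu i hi]
    · exact mul_le_mul_of_nonneg_right (h.mono (Fin.le_def.2 (by simp only; omega))) (sq_nonneg _)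
  have h2 : inner ℝ u (A u) ≤ θ ⟨k, he⟩ * ‖u‖ ^ 2 := by
    rw [h'.inner_map_self huR, ← h'.sum_inner_sq huR, Finset.mul_sum]
    refine Finset.sum_le_sum fun i _ => ?_
    by_cases hi : k < (i : ℕ)
    · simp [hsu i hi]
    · exact mul_le_mul_of_nonneg_right (h'.mono (Fin.le_def.2 (by simp only; omega))) (sq_nonneg _)
  exact le_of_mul_le_mul_right (h1.trans h2) hu0

end IsRitzSystem

/-! ### Frames in nearby subspaces -/

theorem exists_le_finrank_eq [FiniteDimensional ℝ E] {G F : Submodule ℝ E} (hGF : G ≤ F) {k : ℕ}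
    (hG : Module.finrank ℝ G ≤ k) (hF : k ≤ Module.finrank ℝ F) :
    ∃ H : Submodule ℝ E, G ≤ H ∧ H ≤ F ∧ Module.finrank ℝ H = k := by
  obtain ⟨j, rfl⟩ := Nat.exists_eq_add_of_le hG
  clear hG
  induction j with
  | zero => exact ⟨G, le_rfl, hGF, rfl⟩
  | succ j ih =>
    obtain ⟨H, hGH, hHF, hH⟩ := ih (by omega)
    obtain ⟨v, hvF, hvH⟩ := SetLike.exists_of_lt (lt_of_le_of_ne hHF (by rintro rfl; omega))
    refine ⟨H ⊔ Submodule.span ℝ {v}, hGH.trans le_sup_left,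
      sup_le hHF ((Submodule.span_singleton_le_iff_mem _ _).2 hvF), le_antisymm ?_ ?_⟩
    · have h1 := Submodule.finrank_add_le_finrank_add_finrank H (Submodule.span ℝ {v})
      have h2 : Module.finrank ℝ (Submodule.span ℝ {v}) ≤ 1 := by
        simpa using finrank_span_le_card (R := ℝ) ({v} : Set E)
      omega
    · have : H < H ⊔ Submodule.span ℝ {v} := lt_of_le_of_ne le_sup_left fun h =>
        hvH (h ▸ Submodule.mem_sup_right (Submodule.mem_span_singleton_self v))
      have := Submodule.finrank_lt_finrank_of_lt this
      omega

/-- A subspace close to the first `k` Ritz vectors of `F` contains an orthonormal `k`-frame whose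
Rayleigh trace is close to the sum of the first `k` Ritz values. -/
theorem IsRitzSystem.exists_orthonormal_sum_le [FiniteDimensional ℝ E] {A : E →ₗ[ℝ] E}
    {F : Submodule ℝ E} {d : ℕ} {lam : Fin d → ℝ} {x : Fin d → E} (h : IsRitzSystem A F lam x)
    {F' : Submodule ℝ E} (hF' : F' ≤ F) {k : ℕ} (hk : k ≤ Module.finrank ℝ F') {a b ε : ℝ}
    (ha : ∀ i, a ≤ lam i) (hb : ∀ i, lam i ≤ b)
    (hnear : ∀ i : Fin d, (i : ℕ) < k → ∃ y ∈ F', ‖x i - y‖ ^ 2 ≤ ε) :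
    ∃ u : Fin k → E, Orthonormal ℝ u ∧ (∀ j, u j ∈ F') ∧
      ∑ j, inner ℝ (u j) (A (u j)) ≤
        ∑ i ∈ Finset.univ.filter (fun i : Fin d => (i : ℕ) < k), lam i + k * ((b - a) * ε) := by
  have hkd : k ≤ d := h.finrank_eq ▸ hk.trans (Submodule.finrank_mono hF')
  choose! y hyF hy using hnear
  have hG : Module.finrank ℝ
      (Submodule.span ℝ (Set.range fun j : Fin k => y (Fin.castLE hkd j))) ≤ k := by
    simpa [Set.finrank] using
      finrank_range_le_card (R := ℝ) (fun j : Fin k => y (Fin.castLE hkd j))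
  -- The vectors `y i` may be linearly dependent, so their span is enlarged to dimension exactly k
  -- inside `F'`.
  obtain ⟨H, hGH, hHF, hH⟩ := exists_le_finrank_eq (Submodule.span_le.2 (by
    rintro _ ⟨j, rfl⟩; exact hyF _ j.2) : _ ≤ F') hG hk
  have hyH : ∀ i : Fin d, (i : ℕ) < k → y i ∈ H := fun i hi =>
    hGH (Submodule.subset_span ⟨⟨i, hi⟩, rfl⟩)
  let B := (stdOrthonormalBasis ℝ H).reindex (finCongr hH)
  have huo : Orthonormal ℝ (fun j => ((B j : H) : E)) :=
    B.orthonormal.comp_linearIsometry H.subtypeₗᵢ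
  have huF : ∀ j, ((B j : H) : E) ∈ F := fun j => hF' (hHF (B j).2)
  refine ⟨fun j => B j, huo, fun j => hHF (B j).2, ?_⟩
  rw [h.sum_inner_map_self huF]
  refine (sum_mul_le_sum_filter_lt_add hkd hb (fun i => Finset.sum_nonneg fun j _ => sq_nonneg _)
    (h.sum_sum_inner_sq huo huF)).trans ?_
  gcongr
  rw [← sum_filter_lt_const hkd]
  refine Finset.sum_le_sum fun i hi => ?_
  have hik := (Finset.mem_filter.1 hi).2
  have hw : 1 - ∑ j, inner ℝ ((B j : H) : E) (x i) ^ 2 ≤ ε := by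
    refine le_trans ?_ (hy i hik)
    have hyspan : y i ∈ Submodule.span ℝ (Set.range fun j => ((B j : H) : E)) := by
      have h1 : Set.range (fun j => ((B j : H) : E)) = H.subtype '' Set.range B := by
        rw [← Set.range_comp]; rfl
      rw [h1, ← Submodule.map_span, ← OrthonormalBasis.coe_toBasis, Module.Basis.span_eq]
      simpa using hyH i hik
    have h2 := huo.sum_inner_smul_eq hyspan
    have h3 := huo.sum_inner_sq_eq hyspan
    have h4 : inner ℝ (x i) (y i) =
        ∑ j, inner ℝ ((B j : H) : E) (y i) * inner ℝ ((B j : H) : E) (x i) := by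
      conv_lhs => rw [← h2]
      rw [inner_sum]
      exact Finset.sum_congr rfl fun j _ => by rw [inner_smul_right, real_inner_comm (x i)]
    rw [norm_sub_sq_real, h.orthonormal.1 i, ← h3, h4]
    -- The weight of `x i` is the squared norm of its projection to `H`, so its defect is the
    -- squared distance to `H`, at most that to `y i`. Expanding this sum of squares proves it
    -- without projections.
    have h5 : 0 ≤ ∑ j, (inner ℝ ((B j : H) : E) (y i) - inner ℝ ((B j : H) : E) (x i)) ^ 2 :=
      Finset.sum_nonneg fun j _ => sq_nonneg _
    have h6 : ∑ j, (inner ℝ ((B j : H) : E) (y i) - inner ℝ ((B j : H) : E) (x i)) ^ 2 =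
        ∑ j, inner ℝ ((B j : H) : E) (y i) ^ 2 -
        2 * ∑ j, inner ℝ ((B j : H) : E) (y i) * inner ℝ ((B j : H) : E) (x i) +
        ∑ j, inner ℝ ((B j : H) : E) (x i) ^ 2 := by
      rw [Finset.mul_sum, ← Finset.sum_sub_distrib, ← Finset.sum_add_distrib]
      exact Finset.sum_congr rfl fun j _ => by ring
    rw [h6] at h5
    linarith
  have hw0 : 0 ≤ 1 - ∑ j, inner ℝ ((B j : H) : E) (x i) ^ 2 := by
    have := huo.sum_inner_sq_le (x i)
    rw [h.orthonormal.1 i] at this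
    linarith
  calc _ ≤ (b - a) * (1 - ∑ j, inner ℝ ((B j : H) : E) (x i) ^ 2) :=
        mul_le_mul_of_nonneg_right (by linarith [ha i]) hw0
    _ ≤ _ := mul_le_mul_of_nonneg_left hw (by linarith [ha i, hb i])

/-! ### Compression matrices -/

namespace IsOrderedEigendecomposition

variable {N : ℕ} {T S : Matrix (Fin N) (Fin N) ℝ} {θ : Fin N → ℝ}

theorem mul_transpose (h : IsOrderedEigendecomposition T θ S) : S * Sᵀ = 1 :=
  mul_eq_one_comm.1 h.orthonormal

theorem aeval_mul (h : IsOrderedEigendecomposition T θ S) (f : ℝ[X]) :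
    aeval T f * S = S * diagonal fun i => f.eval (θ i) := by
  induction f using Polynomial.induction_on' with
  | add f g hf hg =>
    simp only [map_add, add_mul, hf, hg, eval_add, ← mul_add, diagonal_add]
  | monomial n a =>
    have hpow : T ^ n * S = S * diagonal (fun i => θ i ^ n) := by
      induction n with
      | zero => simp
      | succ n ih =>
        rw [pow_succ, mul_assoc, h.eigen, ← mul_assoc, ih, mul_assoc, diagonal_mul_diagonal]
        simp only [pow_succ]
    have hd : diagonal (fun i => a * θ i ^ n) = a • diagonal fun i => θ i ^ n := by
      rw [← diagonal_smul]; rfl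
    simp only [aeval_monomial, eval_monomial, ← Algebra.smul_def, smul_mul_assoc, hpow, hd,
      Matrix.mul_smul]

theorem transpose_mul_aeval (h : IsOrderedEigendecomposition T θ S) (f : ℝ[X]) :
    Sᵀ * aeval T f = diagonal (fun i => f.eval (θ i)) * Sᵀ := by
  calc Sᵀ * aeval T f = Sᵀ * (aeval T f * S) * Sᵀ := by
        rw [mul_assoc, mul_assoc, h.mul_transpose, mul_one]
    _ = _ := by rw [h.aeval_mul, ← mul_assoc, h.orthonormal, one_mul]

theorem transpose_mulVec_aeval_mulVec (h : IsOrderedEigendecomposition T θ S) (f : ℝ[X])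
    (v : Fin N → ℝ) (i : Fin N) : (Sᵀ *ᵥ (aeval T f *ᵥ v)) i = f.eval (θ i) * (Sᵀ *ᵥ v) i := by
  rw [mulVec_mulVec, h.transpose_mul_aeval, ← mulVec_mulVec, mulVec_diagonal]

theorem transpose_mulVec_mulVec (h : IsOrderedEigendecomposition T θ S)
    (v : Fin N → ℝ) (i : Fin N) : (Sᵀ *ᵥ (T *ᵥ v)) i = θ i * (Sᵀ *ᵥ v) i := by
  simpa using h.transpose_mulVec_aeval_mulVec X v i

theorem aeval_mul_inv (h : IsOrderedEigendecomposition T θ S) {q : ℝ[X]}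
    (hq : ∀ i, q.eval (θ i) ≠ 0) : aeval T q * (aeval T q)⁻¹ = 1 := by
  have h1 : aeval T q * (S * diagonal (fun i => (q.eval (θ i))⁻¹) * Sᵀ) = 1 := by
    rw [← mul_assoc, ← mul_assoc, h.aeval_mul, mul_assoc S, diagonal_mul_diagonal]
    simp only [mul_inv_cancel₀ (hq _)]
    rw [diagonal_one, mul_one, h.mul_transpose]
  rw [inv_eq_right_inv h1, h1]

theorem dotProduct_transpose_mulVec (h : IsOrderedEigendecomposition T θ S) (v : Fin N → ℝ) :
    (Sᵀ *ᵥ v) ⬝ᵥ (Sᵀ *ᵥ v) = v ⬝ᵥ v := by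
  rw [dotProduct_mulVec, vecMul_transpose, mulVec_mulVec, h.mul_transpose, one_mulVec]

end IsOrderedEigendecomposition

namespace IsCompressionMatrix

variable {m l k : ℕ} {tol lmin : ℝ} {T : Matrix (Fin m) (Fin m) ℝ} {V : Matrix (Fin m) (Fin l) ℝ}

theorem transpose_mul_self (hV : IsCompressionMatrix k tol lmin T V) : Vᵀ * V = 1 := by
  obtain ⟨_, _, _, _, _, _, _, _, _, _, _, h, _⟩ := hV
  exact h

theorem exists_mulVec_eq_lastUnit (hV : IsCompressionMatrix k tol lmin T V) :
    ∃ y, V *ᵥ y = lastUnit m := by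
  obtain ⟨_, _, _, _, _, _, _, _, _, _, _, _, _, _, h⟩ := hV
  rwa [← range_mulVecLin] at h

/-- The range of `V` contains k' ≥ k independent eigenvectors. This guarantees that the compressed
space still has room for a k-frame. -/
theorem le_card (hV : IsCompressionMatrix k tol lmin T V) : k ≤ l := by
  obtain ⟨θ, S, k', hk, hk', p, q, hS, -, -, -, -, hspan, -⟩ := hV
  refine hk.trans ?_
  have hind : LinearIndependent ℝ (fun i : Fin k' => S.col (Fin.castLE hk'.le i)) := by
    have h1 : LinearIndependent ℝ S.col := by
      rw [Matrix.linearIndependent_cols_iff_isUnit]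
      exact IsUnit.of_mul_eq_one _ hS.mul_transpose
    exact h1.comp _ (Fin.castLE_injective _)
  have h1 : k' = Module.finrank ℝ (Submodule.span ℝ
      (Set.range fun i : Fin k' => S.col (Fin.castLE hk'.le i))) := by
    rw [finrank_span_eq_card hind, Fintype.card_fin]
  have h2 : Submodule.span ℝ (Set.range fun i : Fin k' => S.col (Fin.castLE hk'.le i)) ≤
      Submodule.span ℝ (Set.range V.col) := by
    rw [hspan]
    refine le_sup_of_le_left (Submodule.span_mono ?_)
    rintro _ ⟨i, rfl⟩
    exact ⟨_, i.2, rfl⟩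
  have h3 := Submodule.finrank_mono h2
  have h4 : Module.finrank ℝ (Submodule.span ℝ (Set.range V.col)) ≤ l := by
    simpa [Set.finrank] using finrank_range_le_card (R := ℝ) V.col
  omega

/-- If `(T - lam) a` is a multiple of `e_m`, for a number `lam` that is not larger than the `k`-th
eigenvalue of `T`, then `a` is close to the range of every compression matrix for `T`. -/
theorem exists_dotProduct_sub_le (hV : IsCompressionMatrix k tol lmin T V) (htol : 0 < tol)
    (htol' : tol < 1 / 2) {lam γ : ℝ} {a : Fin m → ℝ} (hlam : lmin ≤ lam)
    (hT : ∀ θ S, IsOrderedEigendecomposition T θ S →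
      (∀ i, lmin ≤ θ i) ∧ ∀ h : k - 1 < m, lam ≤ θ ⟨k - 1, h⟩)
    (ha : T *ᵥ a = lam • a - γ • lastUnit m) :
    ∃ y, (a - V *ᵥ y) ⬝ᵥ (a - V *ᵥ y) ≤ 4 * tol ^ 2 * (a ⬝ᵥ a) := by
  obtain ⟨θ, S, k', hk, hk', p, q, hS, hgap, hq, hr, -, hspan, -⟩ := hV
  obtain ⟨hθ, hlam'⟩ := hT θ S hS
  have hlamk := hlam' (by omega)
  have hm1 : ∀ i, θ i ≤ θ ⟨m - 1, by omega⟩ := fun i => hS.mono (Fin.le_def.2 (by simp only; omega))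
  -- the rational function at `lam` and at the unwanted eigenvalues
  obtain ⟨hqlam, hrlam⟩ := hr lam ⟨⟨hlam, hlamk.trans (hm1 _)⟩, fun h => absurd h.1 hlamk.not_gt⟩
  rw [stepFun, if_pos (by linarith)] at hrlam
  have hrhalf : 1 / 2 < p.eval lam / q.eval lam := by linarith [(abs_lt.1 hrlam).1]
  have hplam : p.eval lam ≠ 0 := by
    intro h0
    rw [h0, zero_div] at hrhalf
    linarith
  have hrθ : ∀ i : Fin m, k' ≤ (i : ℕ) → |p.eval (θ i) / q.eval (θ i)| < tol := fun i hi => by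
    have hle : θ ⟨k', hk'⟩ ≤ θ i := hS.mono (Fin.le_def.2 hi)
    have h1 := (hr (θ i) ⟨⟨hθ i, hm1 i⟩, fun h => absurd h.2 hle.not_gt⟩).2
    rwa [stepFun, if_neg (by linarith), sub_zero] at h1
  -- the divided difference
  obtain ⟨g, hg⟩ : (X - C lam) ∣ p * C (q.eval lam) - C (p.eval lam) * q := by
    rw [dvd_iff_isRoot]; simp [mul_comm]
  have hgdeg : g.degree < (poleCount p q : ℕ) := by
    by_cases hg0 : g = 0
    · rw [hg0, degree_zero]; exact WithBot.bot_lt_coe _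
    · rw [degree_eq_natDegree hg0, Nat.cast_lt]
      have h1 := congrArg natDegree hg
      rw [natDegree_mul (X_sub_C_ne_zero lam) hg0, natDegree_X_sub_C] at h1
      have h2 : (p * C (q.eval lam) - C (p.eval lam) * q).natDegree ≤
          max p.natDegree q.natDegree :=
        (natDegree_sub_le _ _).trans
          (max_le_max (natDegree_mul_C_le _ _) (natDegree_C_mul_le _ _))
      rw [poleCount]
      omega
  obtain ⟨h, hh⟩ : ∃ h, h = (aeval T q)⁻¹ *ᵥ (aeval T g *ᵥ lastUnit m) := ⟨_, rfl⟩
  have hcoord : ∀ i, q.eval (θ i) * (Sᵀ *ᵥ h) i = g.eval (θ i) * (Sᵀ *ᵥ lastUnit m) i := fun i => by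
    rw [← hS.transpose_mulVec_aeval_mulVec, ← hS.transpose_mulVec_aeval_mulVec, hh,
      mulVec_mulVec _ (aeval T q), hS.aeval_mul_inv hq, one_mulVec]
  have hcoord' : ∀ i, θ i * (Sᵀ *ᵥ a) i = lam * (Sᵀ *ᵥ a) i - γ * (Sᵀ *ᵥ lastUnit m) i :=
    fun i => by
      rw [← hS.transpose_mulVec_mulVec, ha, mulVec_sub, mulVec_smul, mulVec_smul]
      rfl
  -- In eigencoordinates: a - (γ/p(λ)) q(T)⁻¹g(T)e_m = (r(T)/r(λ)) a. Working coordinatewise also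
  -- covers the case where λ is an eigenvalue of `T` and λ - T is singular.
  have hkey : ∀ i, (Sᵀ *ᵥ a) i - γ / p.eval lam * (Sᵀ *ᵥ h) i =
      (p.eval (θ i) / q.eval (θ i)) / (p.eval lam / q.eval lam) * (Sᵀ *ᵥ a) i := fun i => by
    have h1 := congrArg (eval (θ i)) hg
    simp only [eval_sub, eval_mul, eval_C, eval_X] at h1
    have hqi := hq i
    field_simp
    linear_combination (-(Sᵀ *ᵥ a) i) * h1 - γ * hcoord i - g.eval (θ i) * hcoord' i
  -- The retained eigenvectors absorb the remainder in the first k' coordinates exactly; only the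
  -- unwanted coordinates contribute to the error.
  set w : Fin m → ℝ := fun i => if (i : ℕ) < k' then (Sᵀ *ᵥ a) i - γ / p.eval lam * (Sᵀ *ᵥ h) i
    else 0 with hw
  have hmem : (γ / p.eval lam) • h + S *ᵥ w ∈ Submodule.span ℝ (Set.range V.col) := by
    rw [hspan]
    refine Submodule.add_mem _ (Submodule.smul_mem _ _ (Submodule.mem_sup_right
      (Submodule.subset_span ⟨g, hgdeg, hh⟩))) (Submodule.mem_sup_left ?_)
    rw [mulVec_eq_sum]
    refine Submodule.sum_mem _ fun i _ => ?_
    rw [op_smul_eq_smul]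
    by_cases hi : (i : ℕ) < k'
    · exact Submodule.smul_mem _ _ (Submodule.subset_span ⟨i, hi, rfl⟩)
    · simp [hw, hi]
  rw [← range_mulVecLin] at hmem
  obtain ⟨y, hy⟩ := hmem
  rw [mulVecLin_apply] at hy
  refine ⟨y, ?_⟩
  rw [hy, ← hS.dotProduct_transpose_mulVec, ← hS.dotProduct_transpose_mulVec a, dotProduct,
    dotProduct, Finset.mul_sum]
  refine Finset.sum_le_sum fun i _ => ?_
  have hi : (Sᵀ *ᵥ (a - ((γ / p.eval lam) • h + S *ᵥ w))) i =
      (Sᵀ *ᵥ a) i - γ / p.eval lam * (Sᵀ *ᵥ h) i - w i := by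
    rw [mulVec_sub, mulVec_add, mulVec_smul, mulVec_mulVec w, hS.orthonormal, one_mulVec]
    simp [sub_sub]
  rw [hi]
  by_cases hik : (i : ℕ) < k'
  · simp only [hw, if_pos hik, sub_self, mul_zero]
    exact mul_nonneg (by positivity) (mul_self_nonneg _)
  · simp only [hw, if_neg hik, sub_zero, hkey]
    -- Numerator below tol, denominator above 1/2.
    have h1 : |p.eval (θ i) / q.eval (θ i) / (p.eval lam / q.eval lam)| ≤ 2 * tol := by
      rw [abs_div, abs_of_pos (by linarith : 0 < p.eval lam / q.eval lam),
        div_le_iff₀ (by linarith)]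
      nlinarith [hrθ i (not_lt.1 hik)]
    have h2 := sq_le_sq' (abs_le.1 h1).1 (abs_le.1 h1).2
    nlinarith [mul_le_mul_of_nonneg_right h2 (mul_self_nonneg ((Sᵀ *ᵥ a) i))]

end IsCompressionMatrix

/-! ### Matrices as linear maps between Euclidean spaces -/

theorem inner_toLp_eq_dotProduct {n : ℕ} (x y : Fin n → ℝ) :
    inner ℝ (WithLp.toLp 2 x) (WithLp.toLp 2 y) = x ⬝ᵥ y := by
  rw [EuclideanSpace.inner_toLp_toLp, star_trivial, dotProduct_comm]

theorem toEuclideanLin_toLp_eq {n j : ℕ} (Q : Matrix (Fin n) (Fin j) ℝ) (y : Fin j → ℝ) :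
    toEuclideanLin Q (WithLp.toLp 2 y) = WithLp.toLp 2 (Q *ᵥ y) := rfl

theorem mulVec_dotProduct_mulVec {n j : ℕ} (Q R : Matrix (Fin n) (Fin j) ℝ) (x y : Fin j → ℝ) :
    (Q *ᵥ x) ⬝ᵥ (R *ᵥ y) = x ⬝ᵥ ((Qᵀ * R) *ᵥ y) := by
  rw [← mulVec_mulVec, dotProduct_mulVec x, vecMul_transpose]

theorem euclNorm_sq {n : ℕ} (v : Fin n → ℝ) : euclNorm v ^ 2 = v ⬝ᵥ v := by
  rw [← inner_toLp_eq_dotProduct, real_inner_self_eq_norm_sq, euclNorm]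

/-- The column space of a matrix, as a subspace of Euclidean space. -/
def colSpace {n j : ℕ} (Q : Matrix (Fin n) (Fin j) ℝ) : Submodule ℝ (EuclideanSpace ℝ (Fin n)) :=
  LinearMap.range (toEuclideanLin Q)

theorem toLp_mulVec_mem_colSpace {n j : ℕ} (Q : Matrix (Fin n) (Fin j) ℝ) (y : Fin j → ℝ) :
    WithLp.toLp 2 (Q *ᵥ y) ∈ colSpace Q := ⟨WithLp.toLp 2 y, rfl⟩

theorem exists_of_mem_colSpace {n j : ℕ} {Q : Matrix (Fin n) (Fin j) ℝ}
    {u : EuclideanSpace ℝ (Fin n)} (hu : u ∈ colSpace Q) : ∃ y, u = WithLp.toLp 2 (Q *ᵥ y) := by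
  obtain ⟨y, rfl⟩ := hu
  exact ⟨y.ofLp, rfl⟩

theorem colSpace_eq_span {n j : ℕ} (Q : Matrix (Fin n) (Fin j) ℝ) :
    colSpace Q = Submodule.span ℝ (Set.range fun i => WithLp.toLp 2 (Q.col i)) := by
  ext u
  rw [Submodule.mem_span_range_iff_exists_fun]
  have key : ∀ c : Fin j → ℝ, ∑ i, c i • WithLp.toLp 2 (Q.col i) = WithLp.toLp 2 (Q *ᵥ c) := by
    intro c
    rw [mulVec_eq_sum, WithLp.toLp_sum]
    simp only [op_smul_eq_smul]
    rfl
  constructor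
  · intro hu
    obtain ⟨y, rfl⟩ := exists_of_mem_colSpace hu
    exact ⟨y, key y⟩
  · rintro ⟨c, rfl⟩
    rw [key]
    exact toLp_mulVec_mem_colSpace Q c

theorem finrank_colSpace {n j : ℕ} {Q : Matrix (Fin n) (Fin j) ℝ} (hQ : Qᵀ * Q = 1) :
    Module.finrank ℝ (colSpace Q) = j := by
  have hinj : Function.Injective (toEuclideanLin Q) := fun x y hxy => by
    have h1 : Q *ᵥ x.ofLp = Q *ᵥ y.ofLp := congrArg WithLp.ofLp hxy
    have h2 := congrArg (Qᵀ *ᵥ ·) h1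
    simp only [mulVec_mulVec, hQ, one_mulVec] at h2
    exact congrArg (WithLp.toLp 2) h2
  rw [colSpace, LinearMap.finrank_range_of_inj hinj, finrank_euclideanSpace_fin]

theorem sum_filter_lt_eq_sum_castLE {d k : ℕ} (hkd : k ≤ d) (f : Fin d → ℝ) :
    ∑ i ∈ Finset.univ.filter (fun i : Fin d => (i : ℕ) < k), f i =
      ∑ j : Fin k, f (Fin.castLE hkd j) := by
  symm
  refine Finset.sum_bij (fun j _ => Fin.castLE hkd j) (fun j _ => ?_)
    (fun a _ b _ hab => Fin.castLE_injective _ hab) (fun i hi => ?_) fun _ _ => rfl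
  · simp
  · exact ⟨⟨i, (Finset.mem_filter.1 hi).2⟩, Finset.mem_univ _, rfl⟩

/-- The Ritz vectors computed from a matrix with orthonormal columns. -/
theorem IsOrderedEigendecomposition.isRitzSystem {n j : ℕ} {A : Matrix (Fin n) (Fin n) ℝ}
    {Q : Matrix (Fin n) (Fin j) ℝ} (hQ : Qᵀ * Q = 1) {θ : Fin j → ℝ}
    {S : Matrix (Fin j) (Fin j) ℝ} (hS : IsOrderedEigendecomposition (Qᵀ * A * Q) θ S) :
    IsRitzSystem (toEuclideanLin A) (colSpace Q) θ
      (fun i => WithLp.toLp 2 (Q *ᵥ S.col i)) where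
  mono := hS.mono
  orthonormal := by
    rw [orthonormal_iff_ite]
    intro a b
    rw [inner_toLp_eq_dotProduct, mulVec_dotProduct_mulVec, hQ, one_mulVec]
    have := congrFun (congrFun hS.orthonormal a) b
    rw [Matrix.one_apply] at this
    exact this
  span_eq := by
    have hQS : colSpace (Q * S) = colSpace Q := by
      refine le_antisymm ?_ ?_
      · intro u hu
        obtain ⟨y, rfl⟩ := exists_of_mem_colSpace hu
        rw [← mulVec_mulVec]
        exact toLp_mulVec_mem_colSpace _ _
      · intro u hu
        obtain ⟨y, rfl⟩ := exists_of_mem_colSpace hu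
        have : Q *ᵥ y = (Q * S) *ᵥ (Sᵀ *ᵥ y) := by
          rw [mulVec_mulVec, Matrix.mul_assoc, hS.mul_transpose, Matrix.mul_one]
        rw [this]
        exact toLp_mulVec_mem_colSpace _ _
    rw [← hQS, colSpace_eq_span]
    rfl
  ritz := by
    intro i w hw
    obtain ⟨y, rfl⟩ := exists_of_mem_colSpace hw
    have h1 : (Qᵀ * A * Q) *ᵥ S.col i = θ i • S.col i := by
      have := congrArg (fun M => M.col i) hS.eigen
      ext r
      have := congrFun this r
      simp only [Matrix.col_apply, mul_diagonal] at this
      rw [Pi.smul_apply, smul_eq_mul, Matrix.col_apply, mul_comm, ← this]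
      rfl
    rw [toEuclideanLin_toLp_eq, inner_toLp_eq_dotProduct, inner_toLp_eq_dotProduct, mulVec_mulVec,
      mulVec_dotProduct_mulVec, mulVec_dotProduct_mulVec, hQ, one_mulVec, ← Matrix.mul_assoc, h1,
      dotProduct_smul, smul_eq_mul]

/-- All Ritz values of `A` lie between its smallest and largest eigenvalue. -/
theorem IsOrderedEigendecomposition.ritzValue_mem_Icc {n : ℕ} {A X : Matrix (Fin n) (Fin n) ℝ}
    {ev : Fin n → ℝ} (hev : IsOrderedEigendecomposition A ev X) (hn : 0 < n)
    {F : Submodule ℝ (EuclideanSpace ℝ (Fin n))} {d : ℕ} {lam : Fin d → ℝ}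
    {x : Fin d → EuclideanSpace ℝ (Fin n)} (h : IsRitzSystem (toEuclideanLin A) F lam x)
    (i : Fin d) : ev ⟨0, hn⟩ ≤ lam i ∧ lam i ≤ ev ⟨n - 1, by omega⟩ := by
  -- With the identity as basis, the eigenvectors of `A` form a Ritz system of the whole space.
  have h1 : IsOrderedEigendecomposition ((1 : Matrix (Fin n) (Fin n) ℝ)ᵀ * A * 1) ev X := by
    simpa using hev
  have h2 := h1.isRitzSystem (by simp)
  have hx : x i ∈ colSpace (1 : Matrix (Fin n) (Fin n) ℝ) := ⟨x i, by simp⟩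
  have hnorm := h.orthonormal.1 i
  have h3 := h2.le_inner_map_self (a := ev ⟨0, hn⟩)
    (fun j => hev.mono (Fin.le_def.2 (Nat.zero_le _))) hx
  have h4 := h2.inner_map_self_le (b := ev ⟨n - 1, by omega⟩)
    (fun j => hev.mono (Fin.le_def.2 (by simp only; omega))) hx
  rw [h.inner_map_apply, hnorm] at h3 h4
  constructor <;> linarith

/-! ### The standard Lanczos process -/

section Lanczos

variable {n : ℕ} (A : Matrix (Fin n) (Fin n) ℝ) (q₁ : Fin n → ℝ)

/-- The Lanczos vectors in Euclidean space. -/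
def lanczosE (t : ℕ) : EuclideanSpace ℝ (Fin n) := WithLp.toLp 2 (lanczosVec A q₁ t)

/-- The Lanczos vector preceding the one with number `t`, and zero for `t = 0`. -/
def lanczosPrev (t : ℕ) : EuclideanSpace ℝ (Fin n) := WithLp.toLp 2 (lanczosState A q₁ t).1

/-- The coefficient linking `lanczosPrev` and `lanczosE`. -/
def lanczosPrevCoeff (t : ℕ) : ℝ := (lanczosState A q₁ t).2.2

/-- The residual of the three-term recurrence in step `t`. -/
def lanczosResidual (t : ℕ) : EuclideanSpace ℝ (Fin n) :=
  WithLp.toLp 2 (threeTerm A (lanczosState A q₁ t).1 (lanczosState A q₁ t).2.1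
    (lanczosState A q₁ t).2.2)

@[simp] theorem lanczosPrev_zero : lanczosPrev A q₁ 0 = 0 := rfl

@[simp] theorem lanczosPrev_succ (t : ℕ) : lanczosPrev A q₁ (t + 1) = lanczosE A q₁ t := rfl

@[simp] theorem lanczosPrevCoeff_succ (t : ℕ) :
    lanczosPrevCoeff A q₁ (t + 1) = lanczosBeta A q₁ t := rfl

theorem lanczosBeta_eq_norm (t : ℕ) : lanczosBeta A q₁ t = ‖lanczosResidual A q₁ t‖ := rfl

theorem lanczosE_succ (t : ℕ) :
    lanczosE A q₁ (t + 1) = ‖lanczosResidual A q₁ t‖⁻¹ • lanczosResidual A q₁ t := rfl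

/-- At breakdown both sides vanish, so no assumption on the residual is needed. -/
theorem lanczosResidual_eq (t : ℕ) :
    lanczosResidual A q₁ t = lanczosBeta A q₁ t • lanczosE A q₁ (t + 1) := by
  rw [lanczosE_succ, lanczosBeta_eq_norm]
  by_cases h : lanczosResidual A q₁ t = 0
  · simp [h]
  · rw [smul_smul, mul_inv_cancel₀ (norm_ne_zero_iff.2 h), one_smul]

theorem lanczosAlpha_eq_inner (t : ℕ) : lanczosAlpha A q₁ t =
    inner ℝ (lanczosE A q₁ t) (toEuclideanLin A (lanczosE A q₁ t)) := by
  rw [lanczosE, toEuclideanLin_toLp_eq, inner_toLp_eq_dotProduct]; rfl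

theorem toEuclideanLin_lanczosE (t : ℕ) : toEuclideanLin A (lanczosE A q₁ t) =
    lanczosResidual A q₁ t + lanczosAlpha A q₁ t • lanczosE A q₁ t +
      lanczosPrevCoeff A q₁ t • lanczosPrev A q₁ t := by
  have : lanczosResidual A q₁ t = toEuclideanLin A (lanczosE A q₁ t) -
      lanczosAlpha A q₁ t • lanczosE A q₁ t - lanczosPrevCoeff A q₁ t • lanczosPrev A q₁ t := rfl
  rw [this]; abel

variable {A q₁}

/-- Inner products of Lanczos vectors with themselves, given orthonormality. -/
theorem inner_lanczosE {i : ℕ} (ho : Orthonormal ℝ (fun t : Fin i => lanczosE A q₁ t)) {s t : ℕ}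
    (hs : s < i) (ht : t < i) :
    inner ℝ (lanczosE A q₁ s) (lanczosE A q₁ t) = if s = t then 1 else 0 := by
  have := (orthonormal_iff_ite.1 ho) ⟨s, hs⟩ ⟨t, ht⟩
  simpa [Fin.ext_iff] using this

theorem inner_lanczosPrev {i : ℕ} (ho : Orthonormal ℝ (fun t : Fin i => lanczosE A q₁ t))
    {s t : ℕ} (hs : s < i) (ht : t < i) :
    inner ℝ (lanczosE A q₁ s) (lanczosPrev A q₁ t) = if s + 1 = t then 1 else 0 := by
  cases t with
  | zero => simp
  | succ t => simp [inner_lanczosE ho hs (show t < i by omega)]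

theorem inner_toEuclideanLin_comm (hA : A.IsSymm) (u v : EuclideanSpace ℝ (Fin n)) :
    inner ℝ u (toEuclideanLin A v) = inner ℝ (toEuclideanLin A u) v :=
  ((isSymmetric_toEuclideanLin_iff.2 (by rwa [Matrix.IsHermitian, conjTranspose_eq_transpose_of_trivial] :
    A.IsHermitian)) u v).symm

/-- Symmetry moves `A` to the earlier vector, whose recurrence only reaches index s + 1 ≤ t, within
the range where orthonormality is known. -/
theorem inner_lanczosE_toEuclideanLin_of_lt (hA : A.IsSymm) {i : ℕ}
    (ho : Orthonormal ℝ (fun t : Fin i => lanczosE A q₁ t)) {s t : ℕ} (hst : s < t) (ht : t < i) :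
    inner ℝ (lanczosE A q₁ s) (toEuclideanLin A (lanczosE A q₁ t)) =
      if s + 1 = t then lanczosBeta A q₁ s else 0 := by
  rw [inner_toEuclideanLin_comm hA, real_inner_comm, toEuclideanLin_lanczosE, lanczosResidual_eq]
  simp only [inner_add_right, inner_smul_right,
    inner_lanczosE ho ht (show s + 1 < i by omega), inner_lanczosE ho ht (hst.trans ht),
    inner_lanczosPrev ho ht (hst.trans ht), if_neg hst.ne', if_neg (show t + 1 ≠ s by omega)]
  split_ifs <;> first | omega | simp

/-- The α term cancels the case s = t, the β term cancels s + 1 = t, and tridiagonality covers the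
rest. Orthonormality is used only up to index t, which lets `orthonormal_lanczosE_succ` extend it.
-/
theorem inner_lanczosResidual (hA : A.IsSymm) {i : ℕ}
    (ho : Orthonormal ℝ (fun t : Fin i => lanczosE A q₁ t)) {s t : ℕ} (hst : s ≤ t) (ht : t < i) :
    inner ℝ (lanczosE A q₁ s) (lanczosResidual A q₁ t) = 0 := by
  have h1 := congrArg (inner ℝ (lanczosE A q₁ s)) (toEuclideanLin_lanczosE A q₁ t)
  have hs := hst.trans_lt ht
  simp only [inner_add_right, inner_smul_right, inner_lanczosE ho hs ht,
    inner_lanczosPrev ho hs ht] at h1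
  rcases hst.eq_or_lt with rfl | hlt
  · rw [← lanczosAlpha_eq_inner] at h1
    simp at h1
    linarith
  · rw [inner_lanczosE_toEuclideanLin_of_lt hA ho hlt ht, if_neg hlt.ne] at h1
    split_ifs at h1 with h
    · subst h
      simp at h1
      linarith
    · linarith

theorem inner_lanczosE_toEuclideanLin (hA : A.IsSymm) {N : ℕ}
    (ho : Orthonormal ℝ (fun t : Fin N => lanczosE A q₁ t)) (s t : Fin N) :
    inner ℝ (lanczosE A q₁ s) (toEuclideanLin A (lanczosE A q₁ t)) = lanczosMatrix A q₁ N s t := by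
  rw [lanczosMatrix, Matrix.of_apply]
  rcases lt_trichotomy (s : ℕ) t with h | h | h
  · rw [inner_lanczosE_toEuclideanLin_of_lt hA ho h t.2, if_neg (fun hst => h.ne (congrArg Fin.val hst))]
    split_ifs <;> first | rfl | omega
  · obtain rfl := Fin.ext h
    rw [if_pos rfl, lanczosAlpha_eq_inner]
  · rw [inner_toEuclideanLin_comm hA, real_inner_comm,
      inner_lanczosE_toEuclideanLin_of_lt hA ho h s.2, if_neg (fun hst => h.ne' (congrArg Fin.val hst))]
    split_ifs <;> first | rfl | omega

theorem orthonormal_lanczosE_succ (hA : A.IsSymm) {i : ℕ}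
    (ho : Orthonormal ℝ (fun t : Fin (i + 1) => lanczosE A q₁ t))
    (hw : lanczosResidual A q₁ i ≠ 0) :
    Orthonormal ℝ (fun t : Fin (i + 1 + 1) => lanczosE A q₁ t) := by
  have hlast : ∀ s < i + 1, inner ℝ (lanczosE A q₁ s) (lanczosE A q₁ (i + 1)) = 0 := fun s hs => by
    rw [lanczosE_succ, inner_smul_right, inner_lanczosResidual hA ho (by omega) (by omega),
      mul_zero]
  constructor
  · intro t
    by_cases ht : (t : ℕ) < i + 1
    · exact ho.1 ⟨t, ht⟩
    · have : (t : ℕ) = i + 1 := by omega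
      change ‖lanczosE A q₁ t‖ = 1
      rw [this, lanczosE_succ, norm_smul, norm_inv, norm_norm,
        inv_mul_cancel₀ (norm_ne_zero_iff.2 hw)]
  · intro s t hst
    change inner ℝ (lanczosE A q₁ s) (lanczosE A q₁ t) = 0
    have hst' : (s : ℕ) ≠ t := fun h => hst (Fin.ext h)
    by_cases ht : (t : ℕ) < i + 1
    · by_cases hs : (s : ℕ) < i + 1
      · rw [inner_lanczosE ho hs ht, if_neg hst']
      · have : (s : ℕ) = i + 1 := by omega
        rw [this, real_inner_comm]
        exact hlast t ht
    · have : (t : ℕ) = i + 1 := by omega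
      rw [this]
      exact hlast s (by omega)

/-! ### Spans of blocks of Lanczos vectors -/

/-- The span of the Lanczos vectors with numbers in `s`. -/
def lanczosSpan (A : Matrix (Fin n) (Fin n) ℝ) (q₁ : Fin n → ℝ) (s : Set ℕ) :
    Submodule ℝ (EuclideanSpace ℝ (Fin n)) := Submodule.span ℝ (lanczosE A q₁ '' s)

theorem lanczosE_mem_lanczosSpan {s : Set ℕ} {t : ℕ} (ht : t ∈ s) :
    lanczosE A q₁ t ∈ lanczosSpan A q₁ s := Submodule.subset_span ⟨t, ht, rfl⟩

theorem lanczosSpan_mono {s t : Set ℕ} (h : s ⊆ t) : lanczosSpan A q₁ s ≤ lanczosSpan A q₁ t :=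
  Submodule.span_mono (Set.image_mono h)

/-- The coupling of earlier and later Lanczos vectors through `A`. -/
theorem inner_toEuclideanLin_of_mem_lanczosSpan (hA : A.IsSymm) {N i : ℕ}
    (ho : Orthonormal ℝ (fun t : Fin N => lanczosE A q₁ t)) (hi : i + 1 < N)
    {w d : EuclideanSpace ℝ (Fin n)} (hw : w ∈ lanczosSpan A q₁ (Set.Iio (i + 1)))
    (hd : d ∈ lanczosSpan A q₁ (Set.Ico (i + 1) N)) :
    inner ℝ w (toEuclideanLin A d) =
      lanczosBeta A q₁ i * inner ℝ (lanczosE A q₁ (i + 1)) d * inner ℝ w (lanczosE A q₁ i) := by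
  induction hw using Submodule.span_induction with
  | zero => simp
  | add x y _ _ hx hy => rw [inner_add_left, inner_add_left, hx, hy]; ring
  | smul a x _ hx => rw [real_inner_smul_left, real_inner_smul_left, hx]; ring
  | mem w hw =>
    obtain ⟨s, hs, rfl⟩ := hw
    have hs : s < i + 1 := hs
    induction hd using Submodule.span_induction with
    | zero => simp
    | add x y _ _ hx hy => rw [map_add, inner_add_right, inner_add_right, hx, hy]; ring
    | smul a x _ hx => rw [map_smul, real_inner_smul_right, real_inner_smul_right, hx]; ring
    | mem d hd =>
      obtain ⟨t, ⟨ht1, ht2⟩, rfl⟩ := hd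
      -- By tridiagonality only the pair s = i, t = i + 1 across the cut contributes.
      rw [inner_lanczosE_toEuclideanLin_of_lt hA ho (by omega) ht2, inner_lanczosE ho hi ht2,
        inner_lanczosE ho (by omega) (by omega)]
      split_ifs <;> first | omega | (subst_vars; simp_all)

theorem inner_eq_zero_of_mem_lanczosSpan {N : ℕ}
    (ho : Orthonormal ℝ (fun t : Fin N => lanczosE A q₁ t)) {s t : Set ℕ} (hst : Disjoint s t)
    (hs : ∀ a ∈ s, a < N) (ht : ∀ a ∈ t, a < N) {w d : EuclideanSpace ℝ (Fin n)}
    (hw : w ∈ lanczosSpan A q₁ s) (hd : d ∈ lanczosSpan A q₁ t) : inner ℝ w d = 0 := by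
  refine Submodule.IsOrtho.inner_eq (U := lanczosSpan A q₁ s) (V := lanczosSpan A q₁ t) ?_ hw hd
  rw [lanczosSpan, lanczosSpan, Submodule.isOrtho_span]
  rintro _ ⟨a, ha, rfl⟩ _ ⟨b, hb, rfl⟩
  rw [inner_lanczosE ho (hs a ha) (ht b hb), if_neg]
  rintro rfl
  exact Set.disjoint_left.1 hst ha hb

/-- The eigenvectors of the Lanczos matrix give a Ritz system of the Krylov space. -/
theorem IsOrderedEigendecomposition.exists_isRitzSystem_lanczosSpan (hA : A.IsSymm) {N : ℕ}
    (ho : Orthonormal ℝ (fun t : Fin N => lanczosE A q₁ t)) {μ : Fin N → ℝ}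
    {W : Matrix (Fin N) (Fin N) ℝ} (hμ : IsOrderedEigendecomposition (lanczosMatrix A q₁ N) μ W) :
    ∃ x, IsRitzSystem (toEuclideanLin A) (lanczosSpan A q₁ (Set.Iio N)) μ x := by
  let Q : Matrix (Fin n) (Fin N) ℝ := Matrix.of fun r t => lanczosVec A q₁ t r
  have hcol : ∀ t, WithLp.toLp 2 (Q.col t) = lanczosE A q₁ t := fun t => rfl
  have hQ : Qᵀ * Q = 1 := by
    ext s t
    have := (orthonormal_iff_ite.1 ho) s t
    rw [← hcol, ← hcol, inner_toLp_eq_dotProduct] at this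
    rw [Matrix.one_apply, ← this]
    rfl
  have hT : Qᵀ * A * Q = lanczosMatrix A q₁ N := by
    ext s t
    rw [← inner_lanczosE_toEuclideanLin hA ho, ← hcol, ← hcol, toEuclideanLin_toLp_eq,
      inner_toLp_eq_dotProduct, Matrix.mul_assoc]
    rfl
  have hspan : lanczosSpan A q₁ (Set.Iio N) = colSpace Q := by
    rw [colSpace_eq_span, lanczosSpan]
    congr 1
    ext u
    constructor
    · rintro ⟨t, ht, rfl⟩
      exact ⟨⟨t, ht⟩, rfl⟩
    · rintro ⟨t, rfl⟩
      exact ⟨t, t.2, rfl⟩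
  rw [← hT] at hμ
  exact hspan ▸ ⟨_, hμ.isRitzSystem hQ⟩

end Lanczos

/-! ### Appending a column -/

section AppendCol

variable {n j : ℕ}

theorem appendCol_mulVec (Q : Matrix (Fin n) (Fin j) ℝ) (v : Fin n → ℝ) (y : Fin (j + 1) → ℝ) :
    appendCol Q v *ᵥ y = Q *ᵥ (fun i => y i.castSucc) + y (Fin.last j) • v := by
  ext r
  simp [appendCol, mulVec, dotProduct, Fin.sum_univ_castSucc, mul_comm]

theorem colSpace_appendCol (Q : Matrix (Fin n) (Fin j) ℝ) (v : Fin n → ℝ) :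
    colSpace (appendCol Q v) = colSpace Q ⊔ Submodule.span ℝ {WithLp.toLp 2 v} := by
  ext u
  rw [Submodule.mem_sup]
  constructor
  · intro hu
    obtain ⟨y, rfl⟩ := exists_of_mem_colSpace hu
    exact ⟨_, toLp_mulVec_mem_colSpace Q (fun i => y i.castSucc), _,
      Submodule.smul_mem _ (y (Fin.last j)) (Submodule.mem_span_singleton_self _), by
        rw [appendCol_mulVec]; rfl⟩
  · rintro ⟨a, ha, b, hb, rfl⟩
    obtain ⟨y, rfl⟩ := exists_of_mem_colSpace ha
    obtain ⟨c, rfl⟩ := Submodule.mem_span_singleton.1 hb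
    have : WithLp.toLp 2 (Q *ᵥ y) + c • WithLp.toLp 2 v =
        WithLp.toLp 2 (appendCol Q v *ᵥ (Fin.snoc y c : Fin (j + 1) → ℝ)) := by
      rw [appendCol_mulVec]
      simp
    rw [this]
    exact toLp_mulVec_mem_colSpace _ _

theorem appendCol_transpose_mul_self {Q : Matrix (Fin n) (Fin j) ℝ} {v : Fin n → ℝ}
    (hQ : Qᵀ * Q = 1) (hQv : Qᵀ *ᵥ v = 0) (hv : v ⬝ᵥ v = 1) :
    (appendCol Q v)ᵀ * appendCol Q v = 1 := by
  have hcol1 : ∀ a : Fin j, (appendCol Q v).col a.castSucc = Q.col a := fun a => by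
    ext r; simp [appendCol]
  have hcol2 : (appendCol Q v).col (Fin.last j) = v := by
    ext r; simp [appendCol]
  have hQv' : ∀ a, Q.col a ⬝ᵥ v = 0 := fun a => congrFun hQv a
  have key : ∀ a b, ((appendCol Q v)ᵀ * appendCol Q v) a b =
      (appendCol Q v).col a ⬝ᵥ (appendCol Q v).col b := fun a b => rfl
  ext a b
  rw [key]
  induction a using Fin.lastCases with
  | last =>
    induction b using Fin.lastCases with
    | last => simp [hcol2, hv]
    | cast b => rw [hcol1, hcol2, dotProduct_comm, hQv', one_apply_ne (Fin.castSucc_lt_last b).ne']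
  | cast a =>
    induction b using Fin.lastCases with
    | last => rw [hcol1, hcol2, hQv', one_apply_ne (Fin.castSucc_lt_last a).ne]
    | cast b =>
      rw [hcol1, hcol1]
      have := congrFun (congrFun hQ a) b
      rw [Matrix.one_apply] at this ⊢
      simp only [Fin.castSucc_inj]
      exact this

theorem appendCol_mulVec_lastUnit (Q : Matrix (Fin n) (Fin j) ℝ) (v : Fin n → ℝ) :
    appendCol Q v *ᵥ lastUnit (j + 1) = v := by
  have h1 : (fun i : Fin j => lastUnit (j + 1) i.castSucc) = 0 := by
    funext i
    simp only [lastUnit, Fin.val_castSucc, Pi.zero_apply]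
    exact if_neg (by omega)
  rw [appendCol_mulVec, h1]
  simp [lastUnit]

end AppendCol

/-! ### Lanczos with compression -/

section Run

variable {n : ℕ} {A : Matrix (Fin n) (Fin n) ℝ} {q₁ : Fin n → ℝ}

/-- `Q` is an orthonormal basis, ending with the Lanczos vector `v` with number `t`, of a subspace
of the Krylov space that suffices to continue the Lanczos process. -/
structure IsLanczosBasis (A : Matrix (Fin n) (Fin n) ℝ) (q₁ : Fin n → ℝ) (t : ℕ) {j : ℕ}
    (Q : Matrix (Fin n) (Fin j) ℝ) (v : Fin n → ℝ) : Prop where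
  vec_eq : v = lanczosVec A q₁ t
  orthonormal : Orthonormal ℝ (fun s : Fin (t + 1) => lanczosE A q₁ s)
  transpose_mul_self : Qᵀ * Q = 1
  mulVec_lastUnit : Q *ᵥ lastUnit j = v
  prev_mem : lanczosPrev A q₁ t ∈ colSpace Q
  le_lanczosSpan : colSpace Q ≤ lanczosSpan A q₁ (Set.Iio (t + 1))

theorem inner_lanczosResidual_of_mem (hA : A.IsSymm) {t : ℕ}
    (ho : Orthonormal ℝ (fun s : Fin (t + 1) => lanczosE A q₁ s)) {u : EuclideanSpace ℝ (Fin n)}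
    (hu : u ∈ lanczosSpan A q₁ (Set.Iio (t + 1))) : inner ℝ u (lanczosResidual A q₁ t) = 0 := by
  induction hu using Submodule.span_induction with
  | zero => simp
  | add x y _ _ hx hy => rw [inner_add_left, hx, hy, add_zero]
  | smul a x _ hx => rw [real_inner_smul_left, hx, mul_zero]
  | mem u hu =>
    obtain ⟨s, hs, rfl⟩ := hu
    exact inner_lanczosResidual hA ho (Nat.lt_succ_iff.1 hs) (Nat.lt_succ_self t)

namespace IsLanczosBasis

variable {t j : ℕ} {Q : Matrix (Fin n) (Fin j) ℝ} {v : Fin n → ℝ}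

theorem toLp_eq (h : IsLanczosBasis A q₁ t Q v) : WithLp.toLp 2 v = lanczosE A q₁ t := by
  rw [h.vec_eq]; rfl

theorem lanczosE_mem (h : IsLanczosBasis A q₁ t Q v) : lanczosE A q₁ t ∈ colSpace Q := by
  rw [← h.toLp_eq, ← h.mulVec_lastUnit]
  exact toLp_mulVec_mem_colSpace _ _

/-- Orthogonalization against `Q` gives the residual of the three-term recurrence. -/
theorem expansionResidual_eq (h : IsLanczosBasis A q₁ t Q v) (hA : A.IsSymm) :
    WithLp.toLp 2 (expansionResidual A Q v) = lanczosResidual A q₁ t := by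
  set r : Fin n → ℝ := (lanczosResidual A q₁ t).ofLp with hr
  obtain ⟨y, hy⟩ := exists_of_mem_colSpace (Submodule.add_mem _
    (Submodule.smul_mem _ (lanczosAlpha A q₁ t) h.lanczosE_mem)
    (Submodule.smul_mem _ (lanczosPrevCoeff A q₁ t) h.prev_mem))
  -- Both correction terms of the recurrence lie in the range of `Q`, and the residual is orthogonal
  -- to it; so the projection removes precisely the corrections.
  have hAv : A *ᵥ v = r + Q *ᵥ y := by
    have h1 := toEuclideanLin_lanczosE A q₁ t
    rw [add_assoc, hy, ← h.toLp_eq] at h1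
    exact congrArg WithLp.ofLp h1
  have hQr : Qᵀ *ᵥ r = 0 := by
    ext a
    have h1 := inner_lanczosResidual_of_mem hA h.orthonormal
      (h.le_lanczosSpan (colSpace_eq_span Q ▸ Submodule.subset_span ⟨a, rfl⟩ :
        WithLp.toLp 2 (Q.col a) ∈ colSpace Q))
    exact (inner_toLp_eq_dotProduct (Q.col a) r).symm.trans h1
  rw [expansionResidual, hAv, mulVec_add, hQr, zero_add, mulVec_mulVec y, h.transpose_mul_self,
    one_mulVec, add_sub_cancel_right]

theorem nextVec_eq (h : IsLanczosBasis A q₁ t Q v) (hA : A.IsSymm) :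
    nextVec A Q v = lanczosVec A q₁ (t + 1) := by
  have h1 : expansionResidual A Q v = threeTerm A (lanczosState A q₁ t).1
      (lanczosState A q₁ t).2.1 (lanczosState A q₁ t).2.2 :=
    congrArg WithLp.ofLp (h.expansionResidual_eq hA)
  rw [nextVec, h1]
  rfl

theorem lanczosResidual_ne_zero (h : IsLanczosBasis A q₁ t Q v) (hA : A.IsSymm)
    (hz : expansionResidual A Q v ≠ 0) : lanczosResidual A q₁ t ≠ 0 := by
  rw [← h.expansionResidual_eq hA]
  exact fun h0 => hz (congrArg WithLp.ofLp h0)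

/-- Common core of expansion and compression: the old basis need only contain the current Lanczos
vector, which becomes the previous one for the next step. -/
theorem of_appendCol (hA : A.IsSymm) (ho : Orthonormal ℝ (fun s : Fin (t + 1) => lanczosE A q₁ s))
    (hQ : Qᵀ * Q = 1) (hmem : lanczosE A q₁ t ∈ colSpace Q)
    (hle : colSpace Q ≤ lanczosSpan A q₁ (Set.Iio (t + 1))) (hw : lanczosResidual A q₁ t ≠ 0) :
    IsLanczosBasis A q₁ (t + 1) (appendCol Q (lanczosVec A q₁ (t + 1)))
      (lanczosVec A q₁ (t + 1)) where
  vec_eq := rfl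
  orthonormal := orthonormal_lanczosE_succ hA ho hw
  transpose_mul_self := by
    have ho' := orthonormal_lanczosE_succ hA ho hw
    refine appendCol_transpose_mul_self hQ ?_ ?_
    · ext a
      refine (inner_toLp_eq_dotProduct (Q.col a) _).symm.trans ?_
      refine inner_eq_zero_of_mem_lanczosSpan ho' (s := Set.Iio (t + 1)) (t := {t + 1}) (by simp)
        (fun a ha => Nat.lt_succ_of_lt ha) (by simp)
        (hle (colSpace_eq_span Q ▸ Submodule.subset_span ⟨a, rfl⟩))
        (lanczosE_mem_lanczosSpan rfl)
    · rw [← inner_toLp_eq_dotProduct]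
      exact (inner_lanczosE ho' (Nat.lt_succ_self _) (Nat.lt_succ_self _)).trans (if_pos rfl)
  mulVec_lastUnit := appendCol_mulVec_lastUnit _ _
  prev_mem := by
    rw [colSpace_appendCol]
    exact Submodule.mem_sup_left hmem
  le_lanczosSpan := by
    rw [colSpace_appendCol]
    refine sup_le (hle.trans (lanczosSpan_mono (Set.Iio_subset_Iio (by omega)))) ?_
    rw [Submodule.span_singleton_le_iff_mem]
    exact lanczosE_mem_lanczosSpan (Set.mem_Iio.2 (Nat.lt_succ_self (t + 1)))

theorem expand (h : IsLanczosBasis A q₁ t Q v) (hA : A.IsSymm)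
    (hz : expansionResidual A Q v ≠ 0) :
    IsLanczosBasis A q₁ (t + 1) (appendCol Q (nextVec A Q v)) (nextVec A Q v) := by
  rw [h.nextVec_eq hA]
  exact of_appendCol hA h.orthonormal h.transpose_mul_self h.lanczosE_mem h.le_lanczosSpan
    (h.lanczosResidual_ne_zero hA hz)

theorem colSpace_mul_le {j l : ℕ} (Q : Matrix (Fin n) (Fin j) ℝ) (V : Matrix (Fin j) (Fin l) ℝ) :
    colSpace (Q * V) ≤ colSpace Q := by
  intro u hu
  obtain ⟨y, rfl⟩ := exists_of_mem_colSpace hu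
  rw [← mulVec_mulVec]
  exact toLp_mulVec_mem_colSpace _ _

/-- Having e_m in the range of `V` is what keeps the current Lanczos vector in the compressed basis,
and with it the three-term recurrence. -/
theorem compress (h : IsLanczosBasis A q₁ t Q v) (hA : A.IsSymm) {l : ℕ}
    {V : Matrix (Fin j) (Fin l) ℝ} (hV : Vᵀ * V = 1) (hlast : ∃ y, V *ᵥ y = lastUnit j)
    (hz : expansionResidual A Q v ≠ 0) :
    IsLanczosBasis A q₁ (t + 1) (appendCol (Q * V) (nextVec A Q v)) (nextVec A Q v) := by
  rw [h.nextVec_eq hA]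
  refine of_appendCol hA h.orthonormal ?_ ?_ ((colSpace_mul_le Q V).trans h.le_lanczosSpan)
    (h.lanczosResidual_ne_zero hA hz)
  · rw [transpose_mul, Matrix.mul_assoc, ← Matrix.mul_assoc Qᵀ, h.transpose_mul_self,
      Matrix.one_mul, hV]
  · obtain ⟨y, hy⟩ := hlast
    rw [← h.toLp_eq, ← h.mulVec_lastUnit, ← hy, mulVec_mulVec]
    exact toLp_mulVec_mem_colSpace _ _

end IsLanczosBasis

theorem Run.exists_isLanczosBasis (hA : A.IsSymm) (hq₁ : euclNorm q₁ = 1) {k m c i j : ℕ}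
    {tol lmin : ℝ} {Q : Matrix (Fin n) (Fin j) ℝ} {v : Fin n → ℝ}
    (h : Run A q₁ k m tol lmin c i j Q v) : ∃ t, i = t + 1 ∧ IsLanczosBasis A q₁ t Q v := by
  induction h with
  | init =>
    have hdot : q₁ ⬝ᵥ q₁ = 1 := by rw [← euclNorm_sq, hq₁, one_pow]
    have hval : ∀ s : Fin 1, (s : ℕ) = 0 := fun s => by omega
    refine ⟨0, rfl, rfl, ⟨fun s => ?_, fun a b hab => absurd (Fin.ext ((hval a).trans (hval b).symm)) hab⟩,
      ?_, ?_, Submodule.zero_mem _, ?_⟩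
    · change ‖lanczosE A q₁ s‖ = 1
      rw [hval]
      exact hq₁
    · ext a b
      rw [Subsingleton.elim a b, one_apply_eq]
      exact hdot
    · ext r
      simp [mulVec, dotProduct, lastUnit]
    · rw [colSpace_eq_span, Submodule.span_le]
      rintro _ ⟨a, rfl⟩
      exact lanczosE_mem_lanczosSpan (Set.mem_Iio.2 zero_lt_one)
  | expand _ _ hz ih =>
    obtain ⟨t, rfl, hb⟩ := ih
    exact ⟨t + 1, rfl, hb.expand hA hz⟩
  | compress _ V hV hz ih =>
    obtain ⟨t, rfl, hb⟩ := ih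
    exact ⟨t + 1, rfl, hb.compress hA hV.transpose_mul_self hV.exists_mulVec_eq_lastUnit hz⟩

/-! ### Propagation of the Rayleigh trace -/

/-- The subspace `F` contains an orthonormal `k`-frame with Rayleigh trace at most `C`. -/
def HasRayleighTraceLE (A : Matrix (Fin n) (Fin n) ℝ) (k : ℕ)
    (F : Submodule ℝ (EuclideanSpace ℝ (Fin n))) (C : ℝ) : Prop :=
  ∃ u : Fin k → EuclideanSpace ℝ (Fin n), Orthonormal ℝ u ∧ (∀ j, u j ∈ F) ∧
    ∑ j, inner ℝ (u j) (toEuclideanLin A (u j)) ≤ C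

/-- One compression, embedded into the Krylov space that the uncompressed process produces
in `N` steps, increases the minimal Rayleigh trace only slightly. -/
theorem HasRayleighTraceLE.compress (hA : A.IsSymm) {k : ℕ} (hk : 1 ≤ k) {ev : Fin n → ℝ}
    {X : Matrix (Fin n) (Fin n) ℝ} (hev : IsOrderedEigendecomposition A ev X) (hn : 0 < n)
    {tol : ℝ} (htol : 0 < tol) (htol' : tol < 1 / 2) {N t m l : ℕ} (ht : t + 1 < N)
    (ho : Orthonormal ℝ (fun s : Fin N => lanczosE A q₁ s))
    {Q : Matrix (Fin n) (Fin m) ℝ} {v : Fin n → ℝ} (hQ : IsLanczosBasis A q₁ t Q v)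
    {V : Matrix (Fin m) (Fin l) ℝ} (hV : IsCompressionMatrix k tol (ev ⟨0, hn⟩) (Qᵀ * A * Q) V)
    {C : ℝ} (h : HasRayleighTraceLE A k (colSpace Q ⊔ lanczosSpan A q₁ (Set.Ico (t + 1) N)) C) :
    HasRayleighTraceLE A k (colSpace (Q * V) ⊔ lanczosSpan A q₁ (Set.Ico (t + 1) N))
      (C + k * ((ev ⟨n - 1, by omega⟩ - ev ⟨0, hn⟩) * (4 * tol ^ 2))) := by
  obtain ⟨u, huo, huF, hu⟩ := h
  set F := colSpace Q ⊔ lanczosSpan A q₁ (Set.Ico (t + 1) N) with hF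
  have hsymm : (toEuclideanLin A).IsSymmetric :=
    fun x y => (inner_toEuclideanLin_comm hA x y).symm
  obtain ⟨lam, x, hx⟩ := IsRitzSystem.exists_of_isSymmetric hsymm F
  have hQV : (Q * V)ᵀ * (Q * V) = 1 := by
    rw [transpose_mul, Matrix.mul_assoc, ← Matrix.mul_assoc Qᵀ, hQ.transpose_mul_self,
      Matrix.one_mul, hV.transpose_mul_self]
  have hle : colSpace (Q * V) ⊔ lanczosSpan A q₁ (Set.Ico (t + 1) N) ≤ F :=
    sup_le_sup_right (IsLanczosBasis.colSpace_mul_le Q V) _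
  have hkF : k ≤ Module.finrank ℝ
      (colSpace (Q * V) ⊔ lanczosSpan A q₁ (Set.Ico (t + 1) N) : Submodule ℝ _) :=
    hV.le_card.trans ((finrank_colSpace hQV).symm.le.trans (Submodule.finrank_mono le_sup_left))
  have hkd := hkF.trans (Submodule.finrank_mono hle)
  have hCle := hx.sum_le_sum_inner_map_self hk hkd huo huF
  have hnear : ∀ i : Fin (Module.finrank ℝ F), (i : ℕ) < k →
      ∃ y ∈ colSpace (Q * V) ⊔ lanczosSpan A q₁ (Set.Ico (t + 1) N), ‖x i - y‖ ^ 2 ≤ 4 * tol ^ 2 := by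
    intro i hi
    have hxi := hx.mem i
    obtain ⟨p, hp, d, hd, hpd⟩ := Submodule.mem_sup.1 hxi
    obtain ⟨a, rfl⟩ := exists_of_mem_colSpace hp
    have horth : ∀ w ∈ colSpace Q, inner ℝ w d = 0 := fun w hw =>
      inner_eq_zero_of_mem_lanczosSpan ho (s := Set.Iio (t + 1)) (t := Set.Ico (t + 1) N)
        (Set.disjoint_left.2 fun a ha hb => absurd ha (not_lt.2 hb.1))
        (fun a ha => (Set.mem_Iio.1 ha).trans ht) (fun a ha => ha.2) (hQ.le_lanczosSpan hw) hd
    set γ := lanczosBeta A q₁ t * inner ℝ (lanczosE A q₁ (t + 1)) d with hγ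
    have hcouple : ∀ w ∈ colSpace Q,
        inner ℝ w (toEuclideanLin A d) = γ * inner ℝ w (lanczosE A q₁ t) := fun w hw =>
      inner_toEuclideanLin_of_mem_lanczosSpan hA ho ht (hQ.le_lanczosSpan hw) hd
    -- The Ritz condition tested on vectors Qy only: `d` drops out on the right by orthogonality and
    -- enters on the left through γ e_m alone.
    have hTa : (Qᵀ * A * Q) *ᵥ a = lam i • a - γ • lastUnit m := by
      refine dotProduct_eq _ _ fun y => ?_
      rw [dotProduct_comm, dotProduct_comm _ y]
      have hw := toLp_mulVec_mem_colSpace Q y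
      have h1 := hx.ritz i _ (Submodule.mem_sup_left hw : _ ∈ F)
      rw [← hpd, map_add, inner_add_right, inner_add_right, hcouple _ hw, horth _ hw, ← hQ.toLp_eq,
        ← hQ.mulVec_lastUnit, toEuclideanLin_toLp_eq] at h1
      simp only [inner_toLp_eq_dotProduct, mulVec_mulVec, mulVec_dotProduct_mulVec,
        hQ.transpose_mul_self, one_mulVec, ← Matrix.mul_assoc] at h1
      rw [dotProduct_sub, dotProduct_smul, dotProduct_smul, smul_eq_mul, smul_eq_mul]
      linarith
    -- λ ≤ θ_k is Cauchy interlacing for the column space of `Q` inside `F`, after monotonicity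
    -- reduces index i < k to the zero-based index k - 1.
    obtain ⟨y, hy⟩ := hV.exists_dotProduct_sub_le htol htol' (hev.ritzValue_mem_Icc hn hx i).1
      (fun θ S hS => by
        have hr := hS.isRitzSystem hQ.transpose_mul_self
        refine ⟨fun i => (hev.ritzValue_mem_Icc hn hr i).1, fun hkm => ?_⟩
        exact (hx.mono (Fin.le_def.2 (by simp only; omega))).trans
          (hx.apply_le_apply_of_le hr le_sup_left (by omega : k - 1 < Module.finrank ℝ F) hkm)) hTa
    -- The later Lanczos vectors survive compression, so `d` is kept and only the component Qa is
    -- approximated.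
    refine ⟨WithLp.toLp 2 ((Q * V) *ᵥ y) + d, Submodule.add_mem_sup
      (toLp_mulVec_mem_colSpace _ _) hd, ?_⟩
    have hdiff : x i - (WithLp.toLp 2 ((Q * V) *ᵥ y) + d) =
        WithLp.toLp 2 (Q *ᵥ (a - V *ᵥ y)) := by
      rw [← hpd, add_sub_add_right_eq_sub, mulVec_sub, mulVec_mulVec]
      rfl
    have hnorm : ∀ b, ‖WithLp.toLp 2 (Q *ᵥ b)‖ ^ 2 = b ⬝ᵥ b := fun b => by
      rw [← real_inner_self_eq_norm_sq, inner_toLp_eq_dotProduct, mulVec_dotProduct_mulVec,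
        hQ.transpose_mul_self, one_mulVec]
    have ha : a ⬝ᵥ a ≤ 1 := by
      have h1 : ‖x i‖ ^ 2 = 1 := by rw [hx.orthonormal.1 i, one_pow]
      rw [← hpd, norm_add_sq_real, horth _ hp, hnorm] at h1
      nlinarith [sq_nonneg ‖d‖]
    rw [hdiff, hnorm]
    nlinarith [sq_nonneg tol]
  obtain ⟨u', huo', huF', hu'⟩ := hx.exists_orthonormal_sum_le hle hkF
    (fun i => (hev.ritzValue_mem_Icc hn hx i).1) (fun i => (hev.ritzValue_mem_Icc hn hx i).2) hnear
  exact ⟨u', huo', huF', by linarith⟩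

theorem lanczosSpan_Ico_eq {t N : ℕ} (ht : t < N) :
    lanczosSpan A q₁ (Set.Ico t N) =
      Submodule.span ℝ {lanczosE A q₁ t} ⊔ lanczosSpan A q₁ (Set.Ico (t + 1) N) := by
  have : Set.Ico t N = insert t (Set.Ico (t + 1) N) := by
    ext a; simp only [Set.mem_Ico, Set.mem_insert_iff]; omega
  rw [lanczosSpan, this, Set.image_insert_eq, Submodule.span_insert]
  rfl

/-- Induction along the run. An expansion merely moves one Lanczos vector from the future block into
the basis; a compression pays the one-step loss and then does the same. -/
theorem Run.hasRayleighTraceLE (hA : A.IsSymm) (hq₁ : euclNorm q₁ = 1) {k : ℕ} (hk : 1 ≤ k)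
    {ev : Fin n → ℝ} {X : Matrix (Fin n) (Fin n) ℝ} (hev : IsOrderedEigendecomposition A ev X)
    (hn : 0 < n) {tol : ℝ} (htol : 0 < tol) (htol' : tol < 1 / 2) {N : ℕ}
    (ho : Orthonormal ℝ (fun s : Fin N => lanczosE A q₁ s)) {C : ℝ}
    (hC : HasRayleighTraceLE A k (lanczosSpan A q₁ (Set.Iio N)) C) {m c i j : ℕ}
    {Q : Matrix (Fin n) (Fin j) ℝ} {v : Fin n → ℝ}
    (h : Run A q₁ k m tol (ev ⟨0, hn⟩) c i j Q v) (hi : i ≤ N) :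
    HasRayleighTraceLE A k (colSpace Q ⊔ lanczosSpan A q₁ (Set.Ico i N))
      (C + c * (k * ((ev ⟨n - 1, by omega⟩ - ev ⟨0, hn⟩) * (4 * tol ^ 2)))) := by
  induction h with
  | init =>
    have h1 : lanczosSpan A q₁ (Set.Iio N) =
        colSpace (Matrix.of fun r (_ : Fin 1) => q₁ r) ⊔ lanczosSpan A q₁ (Set.Ico 1 N) := by
      -- Initially the basis is the Lanczos vector with number 0, so the sum is the full Krylov
      -- space.
      have h2 : Set.Iio N = Set.Ico 0 N := by ext a; simp
      have h3 : (Set.range fun i => WithLp.toLp 2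
          ((Matrix.of fun r (_ : Fin 1) => q₁ r).col i)) = {lanczosE A q₁ 0} :=
        Set.range_const (ι := Fin 1) (c := lanczosE A q₁ 0)
      rw [h2, lanczosSpan_Ico_eq (by omega), colSpace_eq_span, h3]
    rw [← h1]
    simpa using hC
  | @expand c i j Q v hrun _ _ ih =>
    obtain ⟨t, rfl, hb⟩ := hrun.exists_isLanczosBasis hA hq₁
    have h1 := ih (by omega)
    rw [lanczosSpan_Ico_eq (by omega), ← sup_assoc] at h1
    rwa [colSpace_appendCol, hb.nextVec_eq hA]
  | @compress c i l Q v hrun V hV _ ih =>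
    obtain ⟨t, rfl, hb⟩ := hrun.exists_isLanczosBasis hA hq₁
    have h1 := (ih (by omega)).compress hA hk hev hn htol htol' (by omega) ho hb hV
    rw [lanczosSpan_Ico_eq (by omega), ← sup_assoc] at h1
    rw [colSpace_appendCol, hb.nextVec_eq hA]
    have h2 : C + ((c + 1 : ℕ) : ℝ) * (k * ((ev ⟨n - 1, by omega⟩ - ev ⟨0, hn⟩) * (4 * tol ^ 2))) =
        C + c * (k * ((ev ⟨n - 1, by omega⟩ - ev ⟨0, hn⟩) * (4 * tol ^ 2))) +
          k * ((ev ⟨n - 1, by omega⟩ - ev ⟨0, hn⟩) * (4 * tol ^ 2)) := by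
      push_cast
      ring
    rw [h2]
    exact h1

end Run

end LanczosCompression

end

/-! ### The trace estimate -/

open LanczosCompression in
theorem theorem3p2 {n : ℕ} (A : Matrix (Fin n) (Fin n) ℝ) (hA : A.IsSymm)
    (k : ℕ) (hk : 1 ≤ k) (hkn : k < n)
    (ev : Fin n → ℝ) (X : Matrix (Fin n) (Fin n) ℝ) (hev : IsOrderedEigendecomposition A ev X)
    (hsimple : ∀ i j : Fin n, i < j → (j : ℕ) < k → ev i < ev j)
    (τ : ℝ) (hτ : ev ⟨k - 1, by omega⟩ < τ) (hτ' : τ < ev ⟨k, hkn⟩)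
    (q₁ : Fin n → ℝ) (hq₁ : euclNorm q₁ = 1)
    (tol : ℝ) (htol : 0 < tol) (htol' : tol < 1 / 2)
    (m κ N : ℕ) (U : Matrix (Fin n) (Fin k) ℝ)
    (hU : Returns A q₁ m tol (ev ⟨0, by omega⟩) κ N U)
    (μ : Fin N → ℝ) (W : Matrix (Fin N) (Fin N) ℝ)
    (hμ : IsOrderedEigendecomposition (lanczosMatrix A q₁ N) μ W) :
    (Uᵀ * A * U).trace - ∑ i ∈ Finset.univ.filter (fun i : Fin N => (i : ℕ) < k), μ i ≤
      4 * k * κ * (ev ⟨n - 1, by omega⟩ - ev ⟨0, by omega⟩) * tol ^ 2 := by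
  obtain ⟨Q, v, θ, S, hkm, hrun, hS, rfl⟩ := hU
  have hn : 0 < n := by omega
  obtain ⟨t, rfl, hb⟩ := hrun.exists_isLanczosBasis hA hq₁
  have ho := hb.orthonormal
  obtain ⟨x, hx⟩ := hμ.exists_isRitzSystem_lanczosSpan hA ho
  have hr := hS.isRitzSystem hb.transpose_mul_self
  have hkN : k ≤ t + 1 := by
    rw [← hx.finrank_eq]
    exact hkm.trans ((finrank_colSpace hb.transpose_mul_self).symm.le.trans
      (Submodule.finrank_mono hb.le_lanczosSpan))
  -- The starting frame: the first k Ritz vectors of the uncompressed process.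
  have hC : HasRayleighTraceLE A k (lanczosSpan A q₁ (Set.Iio (t + 1)))
      (∑ i ∈ Finset.univ.filter (fun i : Fin (t + 1) => (i : ℕ) < k), μ i) := by
    refine ⟨fun j => x (Fin.castLE hkN j), hx.orthonormal.comp _ (Fin.castLE_injective hkN),
      fun j => hx.mem _, ?_⟩
    rw [sum_filter_lt_eq_sum_castLE hkN]
    exact Finset.sum_le_sum fun j _ => (hx.inner_map_apply _).le
  obtain ⟨u, huo, huF, hu⟩ := hrun.hasRayleighTraceLE hA hq₁ hk hev hn htol htol' ho hC le_rfl
  -- When the method stops no future vectors remain, so the frame lies in the final search space,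
  -- where the returned Ritz vectors have minimal trace.
  have hbot : lanczosSpan A q₁ (Set.Ico (t + 1) (t + 1)) = ⊥ := by simp [lanczosSpan]
  rw [hbot, sup_bot_eq] at huF
  have hmin := hr.sum_le_sum_inner_map_self hk hkm huo huF
  have htrace : ((Q * S.submatrix id (Fin.castLE hkm))ᵀ * A *
      (Q * S.submatrix id (Fin.castLE hkm))).trace =
      ∑ i ∈ Finset.univ.filter (fun i : Fin m => (i : ℕ) < k), θ i := by
    rw [sum_filter_lt_eq_sum_castLE hkm, Matrix.trace]
    refine Finset.sum_congr rfl fun j _ => ?_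
    rw [← hr.inner_map_apply, toEuclideanLin_toLp_eq, inner_toLp_eq_dotProduct, Matrix.diag_apply,
      Matrix.mul_assoc]
    rfl
  rw [htrace]
  linarith
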